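/- Let $k\in\mathbb N=\{0,1,2,\dots\}$ and $s\in[0,1)$ with $k+s>\frac12$. Let $W\colon\mathbb R\to[0,+\infty)$ be continuous with $W(z)=0$ only if $z\in\{-1,1\}$, and suppose that there are $\alpha,\beta>0$ such that $W(z)\ge\alpha\min\{(z+1)^2,(z-1)^2,\beta\}$ for all $z\in\mathbb R$, and $\overline\eta>0$ and $\gamma$ such that $W(z)\le\gamma\min\{(z+1)^2,(z-1)^2\}$ whenever $||z|-1|\le\overline\eta$. For $u\in H^k(0,1)$ with weak $k$-th derivative $u^{(k)}$ set $$[u]_{k+s}^2=\int_0^1\!\int_0^1\frac{|u^{(k)}(x)-u^{(k)}(y)|^2}{|x-y|^{1+2s}}\,dx\,dy\quad\text{if } s\in(0,1),\qquad [u]_k^2=\int_0^1|u^{(k)}|^2dx\quad\text{if } s=0,$$ let $H^{k+s}(0,1)$ be the set of $u\in H^k(0,1)$ with $[u]_{k+s}<+\infty$, and for $\varepsilon>0$ let $$F_\varepsilon(u)=\frac1\varepsilon\int_0^1W(u(x))\,dx+\varepsilon^{2(k+s)-1}[u]_{k+s}^2 .$$ Theorem (Compactness). Let $\{u_\varepsilon\}_{\varepsilon>0}$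 be a family in $H^{k+s}(0,1)$ such that $\sup_{\varepsilon>0}F_\varepsilon(u_\varepsilon)\le S<+\infty$. Then every sequence of positive numbers converging to $0$ has a subsequence $\varepsilon_r\to0$ for which there is a function $u\in BV((0,1);\{-1,1\})$ (that is, a piecewise-constant function on $(0,1)$ taking only the values $-1$ and $1$) such that $u_{\varepsilon_r}\to u$ in measure on $(0,1)$. Furthermore, if $W(z)\ge c_1|z|^p-c_2$ for all $z\in\mathbb R$, for some $c_1>0$, $c_2\in\mathbb R$ and $p\ge1$, then $u_{\varepsilon_r}\to u$ in $L^p(0,1)$ along the same subsequence. -/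

import Mathlib

open MeasureTheory Set Filter Topology
open scoped ENNReal NNReal ContDiff

noncomputable section

namespace PhaseTransition

/-- `g` is the `l`-th weak derivative of `u` on the open set `I ⊆ ℝ`. -/
def IsWeakDeriv (l : ℕ) (u g : ℝ → ℝ) (I : Set ℝ) : Prop :=
  LocallyIntegrableOn u I volume ∧ LocallyIntegrableOn g I volume ∧
    ∀ φ : ℝ → ℝ, ContDiff ℝ ∞ φ → HasCompactSupport φ → tsupport φ ⊆ I →
      ∫ x in I, u x * iteratedDeriv l φ x = (-1 : ℝ) ^ l * ∫ x in I, g x * φ x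

open Classical in
/-- The weak derivative `u^(l)` on `I`: a representative of the a.e. class of `l`-th weak
derivatives of `u` (it is `0` if there is none). -/
def weakDeriv (l : ℕ) (u : ℝ → ℝ) (I : Set ℝ) : ℝ → ℝ :=
  if h : ∃ g, IsWeakDeriv l u g I then Classical.choose h else 0

/-- The squared seminorm `[u]²_{k+s}(I)`: the squared Gagliardo `s`-seminorm of `u^(k)` if
`s ≠ 0`, and the squared `L²`-norm of `u^(k)` if `s = 0`. -/
def seminormSq (k : ℕ) (s : ℝ) (u : ℝ → ℝ) (I : Set ℝ) : ℝ≥0∞ :=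
  if s = 0 then
    ∫⁻ x in I, ENNReal.ofReal (|weakDeriv k u I x| ^ 2)
  else
    ∫⁻ z in I ×ˢ I, ENNReal.ofReal
      (|weakDeriv k u I z.1 - weakDeriv k u I z.2| ^ 2 / |z.1 - z.2| ^ (1 + 2 * s))

/-- `u` belongs to the classical Sobolev space `H^k(I)`. -/
def MemH (k : ℕ) (u : ℝ → ℝ) (I : Set ℝ) : Prop :=
  MemLp u 2 (volume.restrict I) ∧
    ∀ l ≤ k, ∃ g : ℝ → ℝ, IsWeakDeriv l u g I ∧ MemLp g 2 (volume.restrict I)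

/-- `u` belongs to the fractional Sobolev space `H^{k+s}(I)`, `0 ≤ s < 1`. -/
def MemHs (k : ℕ) (s : ℝ) (u : ℝ → ℝ) (I : Set ℝ) : Prop :=
  MemH k u I ∧ seminormSq k s u I < ⊤

/-- The double-well potentials: non-negative and continuous, vanishing only at the wells `±1`,
bounded below by a truncated quadratic, and at most quadratic near the wells. -/
structure IsDoubleWell (W : ℝ → ℝ) : Prop where
  continuous : Continuous W
  nonneg : ∀ z, 0 ≤ W z
  eq_zero : ∀ z, W z = 0 → z = -1 ∨ z = 1
  lower : ∃ α > 0, ∃ β > 0, ∀ z, α * min (min ((z + 1) ^ 2) ((z - 1) ^ 2)) β ≤ W z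
  upper : ∃ η > 0, ∃ γ : ℝ, ∀ z, |(|z| - 1)| ≤ η → W z ≤ γ * min ((z + 1) ^ 2) ((z - 1) ^ 2)

/-- The energy `F_ε(u; I) = (1/ε) ∫_I W(u) dx + ε^{2(k+s)-1} [u]²_{k+s}(I)`. -/
def energy (W : ℝ → ℝ) (k : ℕ) (s ε : ℝ) (u : ℝ → ℝ) (I : Set ℝ) : ℝ≥0∞ :=
  ENNReal.ofReal (1 / ε) * (∫⁻ x in I, ENNReal.ofReal (W (u x))) +
    ENNReal.ofReal (ε ^ (2 * ((k : ℝ) + s) - 1)) * seminormSq k s u I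

/-- `v` belongs to `BV(I; {-1,1})`, for an interval `I`: it takes only the values `-1` and `1` on
`I` and has bounded variation there, that is, it is piecewise constant. -/
def MemBVSign (v : ℝ → ℝ) (I : Set ℝ) : Prop :=
  BoundedVariationOn v I ∧ ∀ x ∈ I, v x = -1 ∨ v x = 1

end PhaseTransition

end

/-! At scale `ε` the energy is scale invariant: on a window of length comparable to `ε`, small
energy forces `u` to be close in measure both to `{-1, 1}` and to a polynomial of degree at most
`k`. Closeness to the wells comes from the lower bound on `W` and Markov's inequality. For the
polynomial, a Poincaré inequality makes the `k`-th derivative nearly constant in `L¹`, and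
integrating `k` times, after mollification, yields the approximant `P`
(`IsWeakDeriv.exists_polynomial_measure_le`).

Then `P ^ 2 - 1` is small off a set of small measure. By Lagrange interpolation it is small on the
whole window, so `P` has no zero there and `u` stays near a single well
(`exists_sign_of_localEnergy_le`). Thus a transition costs at least a fixed energy `δ`, and
intermediate derivatives never need to be estimated.

Windows of size about `ε` overlap at most four times, so at most `4 * S / δ` of them are expensive.
Neighbouring cheap windows share a well because their cores overlap. Hence `u` is close in measure
to a `±1` step function whose number of jumps is bounded independently of `ε`
(`exists_signStep_close`). Such step functions are parametrized by a compact set, which gives the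
subsequence. Under `p`-growth, the potential energy, of order `ε`, controls large values of `u` and
upgrades convergence in measure to `L^p`. -/

namespace PhaseTransition

open scoped Convolution

/-! ### Polynomials controlled off a set of small measure -/

/-- A polynomial bounded by `κ` on an interval off a set of small measure is bounded by a multiple
of `κ` on the whole interval. -/
lemma abs_eval_le_of_small_off {n : ℕ} {Q : Polynomial ℝ} (hQ : Q.natDegree ≤ n)
    {a L κ : ℝ} (hL : 0 < L) {E : Set ℝ} (hE : volume E < ENNReal.ofReal (L / (2 * n + 1)))
    (hκ : ∀ x ∈ Icc a (a + L), x ∉ E → |Q.eval x| ≤ κ) {x : ℝ} (hx : x ∈ Icc a (a + L)) :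
    |Q.eval x| ≤ (n + 1) * (2 * n + 1) ^ n * κ := by
  set d : ℝ := L / (2 * n + 1) with hd
  have hd0 : 0 < d := by positivity
  have hdL : d * (2 * n + 1) = L := by rw [hd]; field_simp
  -- Of the `2n+1` pieces of length `d`, every second one supplies an interpolation node. Each piece
  -- is larger than `E`, and the skipped pieces keep distinct nodes at least `d` apart.
  have hex : ∀ i : ℕ, ∃ y ∈ Icc (a + 2 * i * d) (a + 2 * i * d + d), y ∉ E := by
    intro i
    by_contra! h
    have : volume (Icc (a + 2 * i * d) (a + 2 * i * d + d)) ≤ volume E := measure_mono h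
    rw [Real.volume_Icc] at this
    simp only [add_sub_cancel_left] at this
    exact absurd hE (not_lt.mpr this)
  choose v hv hvE using hex
  have hsep : ∀ i j : ℕ, i < j → d ≤ v j - v i := by
    intro i j hij
    have h1 := (hv i).2
    have h2 := (hv j).1
    have : (i : ℝ) + 1 ≤ j := by exact_mod_cast hij
    nlinarith
  have hsep' : ∀ i j : ℕ, i ≠ j → d ≤ |v i - v j| := by
    intro i j hij
    rcases lt_or_gt_of_ne hij with h | h
    · rw [abs_sub_comm]; exact (hsep i j h).trans (le_abs_self _)
    · exact (hsep j i h).trans (le_abs_self _)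
  have hinj : Set.InjOn v (Finset.range (n + 1)) := by
    intro i _ j _ hij
    by_contra hne
    have := hsep' i j hne
    rw [hij, sub_self, abs_zero] at this
    linarith
  have hmem : ∀ i ∈ Finset.range (n + 1), v i ∈ Icc a (a + L) := by
    intro i hi
    have hi' : (i : ℝ) ≤ n := by
      have := Finset.mem_range.mp hi
      exact_mod_cast Nat.lt_succ_iff.mp this
    have h0 : (0 : ℝ) ≤ i := i.cast_nonneg
    refine ⟨le_trans ?_ (hv i).1, (hv i).2.trans ?_⟩ <;> nlinarith
  have hdeg : Q.degree < (Finset.range (n + 1)).card := by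
    rw [Finset.card_range]
    exact Polynomial.degree_le_natDegree.trans_lt (by exact_mod_cast Nat.lt_succ_of_le hQ)
  rw [Lagrange.eq_interpolate hinj hdeg, Lagrange.interpolate_apply, Polynomial.eval_finsetSum]
  refine (Finset.abs_sum_le_sum_abs _ _).trans ?_
  have hterm : ∀ i ∈ Finset.range (n + 1), |Polynomial.eval x (Polynomial.C (Q.eval (v i)) *
      Lagrange.basis (Finset.range (n + 1)) v i)| ≤ κ * (2 * n + 1) ^ n := by
    intro i hi
    rw [Polynomial.eval_mul, Polynomial.eval_C, abs_mul]
    have h1 : |Q.eval (v i)| ≤ κ := hκ _ (hmem i hi) (hvE i)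
    refine mul_le_mul h1 ?_ (abs_nonneg _) ((abs_nonneg _).trans h1)
    rw [Lagrange.basis, Polynomial.eval_prod, Finset.abs_prod]
    have hcard : ((Finset.range (n + 1)).erase i).card = n := by
      rw [Finset.card_erase_of_mem hi, Finset.card_range]; rfl
    calc ∏ j ∈ (Finset.range (n + 1)).erase i,
          |Polynomial.eval x (Lagrange.basisDivisor (v i) (v j))|
        ≤ ∏ _j ∈ (Finset.range (n + 1)).erase i, ((2 * n + 1 : ℝ)) := by
          -- Each factor is `|x - v j| / |v i - v j|`, at most `L / d = 2n+1`.
          refine Finset.prod_le_prod (fun _ _ => abs_nonneg _) fun j hj => ?_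
          have hne : i ≠ j := (Finset.ne_of_mem_erase hj).symm
          have hj' := hmem j (Finset.mem_of_mem_erase hj)
          have hs := hsep' i j hne
          simp only [Lagrange.basisDivisor, Polynomial.eval_mul, Polynomial.eval_C,
            Polynomial.eval_sub, Polynomial.eval_X, abs_mul, abs_inv]
          rw [inv_mul_le_iff₀ (by linarith), abs_le]
          constructor <;> nlinarith [hx.1, hx.2, hj'.1, hj'.2, (n.cast_nonneg : (0 : ℝ) ≤ n)]
      _ = (2 * n + 1) ^ n := by rw [Finset.prod_const, hcard]
  refine (Finset.sum_le_sum hterm).trans (le_of_eq ?_)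
  rw [Finset.sum_const, Finset.card_range, nsmul_eq_mul]
  push_cast
  ring

/-- A polynomial close to `±1` on an interval off a set of small measure has constant sign. -/
lemma polynomial_constant_sign {k : ℕ} {P : Polynomial ℝ} (hP : P.natDegree ≤ k)
    {a L κ : ℝ} (hL : 0 < L) {E : Set ℝ} (hE : volume E < ENNReal.ofReal (L / (4 * k + 1)))
    (hκ : (2 * k + 1) * (4 * k + 1) ^ (2 * k) * κ < 1)
    (h : ∀ x ∈ Icc a (a + L), x ∉ E → |P.eval x ^ 2 - 1| ≤ κ) :
    (∀ x ∈ Icc a (a + L), 0 < P.eval x) ∨ (∀ x ∈ Icc a (a + L), P.eval x < 0) := by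
  have hne : ∀ x ∈ Icc a (a + L), P.eval x ≠ 0 := by
    intro x hx h0
    -- At a zero of `P` the polynomial `P ^ 2 - 1` has modulus 1, which the bound for degree `2 * k`
    -- excludes by `hκ`.
    have hdeg : (P ^ 2 - 1).natDegree ≤ 2 * k := by
      refine (Polynomial.natDegree_sub_le _ _).trans ?_
      simp only [Polynomial.natDegree_one, max_le_iff, zero_le, and_true]
      exact Polynomial.natDegree_pow_le.trans (by omega)
    have hb := abs_eval_le_of_small_off hdeg hL (κ := κ) (a := a) (E := E)
      (by push_cast; convert hE using 3; ring)
      (fun y hy hyE => by simpa using h y hy hyE) hx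
    simp only [Polynomial.eval_sub, Polynomial.eval_pow, Polynomial.eval_one, h0] at hb
    norm_num at hb
    have h3 : (2 * (2 * (k : ℝ)) + 1) = 4 * k + 1 := by ring
    rw [h3] at hb
    linarith
  by_contra! hcon
  obtain ⟨⟨x, hx, hx0⟩, y, hy, hy0⟩ := hcon
  obtain ⟨z, hz, hz0⟩ := isPreconnected_Icc.intermediate_value hx hy
    P.continuous.continuousOn ⟨hx0, hy0⟩
  exact hne z hz hz0

/-! ### Polynomial approximation from the weak derivative -/

lemma exists_polynomial_antiderivative (Q : Polynomial ℝ) :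
    ∃ R : Polynomial ℝ, R.natDegree ≤ Q.natDegree + 1 ∧ Polynomial.derivative R = Q := by
  refine ⟨∑ i ∈ Finset.range (Q.natDegree + 1),
    Polynomial.monomial (i + 1) (Q.coeff i / (i + 1)), ?_, ?_⟩
  · refine Polynomial.natDegree_sum_le_of_forall_le _ _ fun i hi => ?_
    exact (Polynomial.natDegree_monomial_le _).trans (by have := Finset.mem_range.mp hi; omega)
  · rw [Polynomial.derivative_sum]
    conv_rhs => rw [Q.as_sum_range]
    refine Finset.sum_congr rfl fun i _ => ?_
    rw [Polynomial.derivative_monomial]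
    congr 1
    push_cast
    field_simp

/-- A smooth function whose `k`-th derivative is close to a constant in `L¹` is close in `L¹` to a
polynomial of degree at most `k`. -/
lemma exists_polynomial_integral_le (k : ℕ) {f : ℝ → ℝ} (hf : ContDiff ℝ ∞ f) {a b : ℝ}
    (hab : a ≤ b) (c : ℝ) :
    ∃ P : Polynomial ℝ, P.natDegree ≤ k ∧
      ∫ x in a..b, |f x - P.eval x| ≤ (b - a) ^ k * ∫ x in a..b, |iteratedDeriv k f x - c| := by
  induction k generalizing f with
  | zero => exact ⟨Polynomial.C c, by simp, by simp⟩
  | succ k ih =>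
    have hf' : ContDiff ℝ ∞ (deriv f) := ((contDiff_infty_iff_deriv (𝕜 := ℝ)).mp hf).2
    obtain ⟨Q, hQ, hQi⟩ := ih hf'
    obtain ⟨R, hR, hRd⟩ := exists_polynomial_antiderivative Q
    -- The constant of integration makes the error vanish at `a`; the error is then at most the `L¹`
    -- error of the derivative, and integrating it costs one factor `b - a`.
    refine ⟨R + Polynomial.C (f a - R.eval a), ?_, ?_⟩
    · refine (Polynomial.natDegree_add_le _ _).trans (max_le (hR.trans (by omega)) ?_)
      simp
    rw [iteratedDeriv_succ']
    have hcont : Continuous fun x => |deriv f x - Q.eval x| :=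
      (hf'.continuous.sub Q.continuous).abs
    have hpt : ∀ x ∈ Icc a b, |f x - (R + Polynomial.C (f a - R.eval a)).eval x| ≤
        ∫ t in a..b, |deriv f t - Q.eval t| := by
      intro x hx
      have hFTC : ∫ t in a..x, (deriv f t - Q.eval t) = (f x - R.eval x) - (f a - R.eval a) := by
        refine intervalIntegral.integral_eq_sub_of_hasDerivAt
          (f := fun t => f t - R.eval t) (fun t _ => ?_)
          ((hf'.continuous.sub Q.continuous).intervalIntegrable _ _)
        have h1 := ((hf.differentiable (by simp)) t).hasDerivAt
        have h2 := R.hasDerivAt t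
        rw [hRd] at h2
        exact h1.sub h2
      have : f x - (R + Polynomial.C (f a - R.eval a)).eval x
          = ∫ t in a..x, (deriv f t - Q.eval t) := by
        rw [hFTC, Polynomial.eval_add, Polynomial.eval_C]; ring
      rw [this]
      refine (intervalIntegral.abs_integral_le_integral_abs hx.1).trans ?_
      exact intervalIntegral.integral_mono_interval le_rfl hx.1 hx.2
        (Eventually.of_forall fun t => abs_nonneg _) (hcont.intervalIntegrable _ _)
    calc ∫ x in a..b, |f x - (R + Polynomial.C (f a - R.eval a)).eval x|
        ≤ ∫ _x in a..b, ∫ t in a..b, |deriv f t - Q.eval t| := by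
          refine intervalIntegral.integral_mono_on hab ?_ (by simp) hpt
          exact ((hf.continuous.sub (Polynomial.continuous _)).abs).intervalIntegrable _ _
      _ = (b - a) * ∫ t in a..b, |deriv f t - Q.eval t| := by simp
      _ ≤ (b - a) * ((b - a) ^ k * ∫ x in a..b, |iteratedDeriv k (deriv f) x - c|) := by
          exact mul_le_mul_of_nonneg_left hQi (by linarith)
      _ = _ := by ring

lemma iteratedDeriv_convolution_left (k : ℕ) {ψ w : ℝ → ℝ} (hψ : ContDiff ℝ ∞ ψ)
    (hc : HasCompactSupport ψ) (hw : LocallyIntegrable w volume) :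
    iteratedDeriv k (ψ ⋆[ContinuousLinearMap.lsmul ℝ ℝ, volume] w) =
      (iteratedDeriv k ψ) ⋆[ContinuousLinearMap.lsmul ℝ ℝ, volume] w := by
  induction k generalizing ψ with
  | zero => simp
  | succ k ih =>
    have hd : deriv (ψ ⋆[ContinuousLinearMap.lsmul ℝ ℝ, volume] w) =
        (deriv ψ) ⋆[ContinuousLinearMap.lsmul ℝ ℝ, volume] w := by
      funext x
      exact (hc.hasDerivAt_convolution_left _ (hψ.of_le (by simp)) hw x).deriv
    rw [iteratedDeriv_succ', iteratedDeriv_succ', hd]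
    exact ih ((contDiff_infty_iff_deriv (𝕜 := ℝ)).mp hψ).2 hc.deriv

/-- Away from the boundary, derivatives of a mollification are mollifications of the weak
derivative. -/
lemma IsWeakDeriv.iteratedDeriv_mollification {k : ℕ} {u g : ℝ → ℝ} {I : Set ℝ}
    (hI : MeasurableSet I) (h : IsWeakDeriv k u g I) (hu : IntegrableOn u I)
    (φ : ContDiffBump (0 : ℝ)) {x : ℝ} (hx : Metric.closedBall x φ.rOut ⊆ I) :
    iteratedDeriv k
        (φ.normed volume ⋆[ContinuousLinearMap.lsmul ℝ ℝ, volume] (I.indicator u)) x =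
      ∫ t in I, φ.normed volume (x - t) * g t := by
  have hψ : ContDiff ℝ ∞ (φ.normed (volume : Measure ℝ)) := φ.contDiff_normed
  have hc : HasCompactSupport (φ.normed (volume : Measure ℝ)) := φ.hasCompactSupport_normed
  have hu' : Integrable (I.indicator u) := hu.integrable_indicator hI
  rw [iteratedDeriv_convolution_left k hψ hc hu'.locallyIntegrable, convolution_lsmul_swap]
  have hsupp : Function.support (fun t => φ.normed volume (x - t)) ⊆
      Metric.closedBall x φ.rOut := by
    intro t ht
    have h1 : x - t ∈ Function.support (φ.normed (volume : Measure ℝ)) := ht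
    rw [ContDiffBump.support_normed_eq, Metric.mem_ball, dist_zero_right] at h1
    rw [Metric.mem_closedBall, dist_comm, dist_eq_norm]
    exact h1.le
  -- The reflected mollifier is the test function. Reflection contributes `(-1) ^ k`, which cancels
  -- the sign in the definition of the weak derivative.
  have htest := h.2.2 (fun t => φ.normed volume (x - t)) (hψ.comp (by fun_prop))
    (HasCompactSupport.of_support_subset_isCompact (isCompact_closedBall _ _) hsupp)
    ((closure_minimal hsupp Metric.isClosed_closedBall).trans hx)
  rw [iteratedDeriv_comp_const_sub] at htest
  have e1 : ∫ t, iteratedDeriv k (φ.normed volume) (x - t) • I.indicator u t =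
      ∫ t in I, iteratedDeriv k (φ.normed volume) (x - t) * u t := by
    rw [← integral_indicator hI]
    refine integral_congr_ae (Eventually.of_forall fun t => ?_)
    by_cases ht : t ∈ I <;> simp [ht]
  have e2 : ∫ t in I, u t * (-1 : ℝ) ^ k • iteratedDeriv k (φ.normed volume) (x - t) =
      (-1) ^ k * ∫ t in I, iteratedDeriv k (φ.normed volume) (x - t) * u t := by
    rw [← integral_const_mul]
    refine integral_congr_ae (Eventually.of_forall fun t => ?_)
    simp only [smul_eq_mul]
    ring
  rw [e2] at htest
  have e3 := mul_left_cancel₀ (pow_ne_zero k (by norm_num : (-1 : ℝ) ≠ 0)) htest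
  rw [e1, e3]
  refine integral_congr_ae (Eventually.of_forall fun t => ?_)
  simp only []
  ring

/-- Mollification does not increase the `L¹`-distance of the weak derivative to a constant. -/
lemma IsWeakDeriv.integral_mollification_le {k : ℕ} {u g : ℝ → ℝ} {I : Set ℝ}
    (hI : MeasurableSet I) (h : IsWeakDeriv k u g I) (hu : IntegrableOn u I)
    (hg : IntegrableOn g I) (φ : ContDiffBump (0 : ℝ)) {a b ρ : ℝ} (hab : a ≤ b)
    (hρ : φ.rOut < ρ) (hsub : Ioo (a - ρ) (b + ρ) ⊆ I) (c : ℝ) :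
    ∫ x in a..b, |iteratedDeriv k
        (φ.normed volume ⋆[ContinuousLinearMap.lsmul ℝ ℝ, volume] (I.indicator u)) x - c| ≤
      ∫ x in Ioo (a - ρ) (b + ρ), |g x - c| := by
  set J := Ioo (a - ρ) (b + ρ) with hJ
  set ψ := φ.normed (volume : Measure ℝ) with hψdef
  set G : ℝ → ℝ := J.indicator (fun x => |g x - c|) with hG
  have hJm : MeasurableSet J := measurableSet_Ioo
  have hgc : IntegrableOn (fun x => |g x - c|) J := by
    refine Integrable.abs ((hg.mono_set hsub).sub ?_)
    exact integrableOn_const (by simp [hJ])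
  have hGi : Integrable G := hgc.integrable_indicator hJm
  have hψi : Integrable ψ := φ.integrable_normed
  have hu' : Integrable (I.indicator u) := hu.integrable_indicator hI
  have hcont : Continuous (ψ : ℝ → ℝ) := φ.continuous_normed
  have hcc : HasCompactSupport ψ := φ.hasCompactSupport_normed
  have hf : ContDiff ℝ ∞ (ψ ⋆[ContinuousLinearMap.lsmul ℝ ℝ, volume] (I.indicator u)) :=
    hcc.contDiff_convolution_left _ φ.contDiff_normed hu'.locallyIntegrable
  obtain ⟨B, hB⟩ := hcont.bounded_above_of_compact_support hcc
  have hnn : ∀ x, 0 ≤ (ψ ⋆[ContinuousLinearMap.lsmul ℝ ℝ, volume] G) x := by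
    intro x
    rw [convolution_lsmul_swap]
    refine integral_nonneg fun t => ?_
    exact mul_nonneg (φ.nonneg_normed _) (indicator_nonneg (fun _ _ => abs_nonneg _) _)
  have hci : Integrable (ψ ⋆[ContinuousLinearMap.lsmul ℝ ℝ, volume] G) :=
    hψi.integrable_convolution _ hGi
  have hpt : ∀ x ∈ Icc a b, |iteratedDeriv k
      (ψ ⋆[ContinuousLinearMap.lsmul ℝ ℝ, volume] (I.indicator u)) x - c| ≤
      (ψ ⋆[ContinuousLinearMap.lsmul ℝ ℝ, volume] G) x := by
    intro x hx
    have hball : Metric.closedBall x φ.rOut ⊆ J := by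
      intro t ht
      rw [Real.closedBall_eq_Icc] at ht
      exact ⟨by linarith [ht.1, hx.1], by linarith [ht.2, hx.2]⟩
    rw [h.iteratedDeriv_mollification hI hu φ (hball.trans hsub), convolution_lsmul_swap]
    -- Since the mollifier has mass one, `c` can be moved under the integral.
    have hψ1 : ∫ t, ψ (x - t) = 1 := by
      rw [integral_sub_left_eq_self (fun t => ψ t) volume x]
      exact φ.integral_normed
    have hψ0 : ∀ t, t ∉ J → ψ (x - t) = 0 := by
      intro t ht
      by_contra hne
      have h1 : x - t ∈ Function.support ψ := hne
      rw [hψdef, ContDiffBump.support_normed_eq, Metric.mem_ball, dist_zero_right] at h1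
      refine ht (hball ?_)
      rw [Metric.mem_closedBall, dist_comm, dist_eq_norm]
      exact h1.le
    have hint : Integrable (fun t => ψ (x - t) * I.indicator g t) :=
      (hg.integrable_indicator hI).bdd_mul
        ((hcont.comp (by fun_prop)).aestronglyMeasurable) (Eventually.of_forall fun t => hB (x - t))
    have e1 : ∫ t in I, ψ (x - t) * g t = ∫ t, ψ (x - t) * I.indicator g t := by
      rw [← integral_indicator hI]
      refine integral_congr_ae (Eventually.of_forall fun t => ?_)
      by_cases ht : t ∈ I <;> simp [ht]
    rw [show (∫ t in I, ψ (x - t) * g t) - c = ∫ t, ψ (x - t) * (I.indicator g t - c) by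
      simp only [mul_sub]
      rw [integral_sub hint ((hψi.comp_sub_left x).mul_const c), integral_mul_const, hψ1, one_mul,
        e1]]
    refine (abs_integral_le_integral_abs).trans (le_of_eq ?_)
    refine integral_congr_ae (Eventually.of_forall fun t => ?_)
    simp only [abs_mul, smul_eq_mul, abs_of_nonneg (φ.nonneg_normed (μ := volume) (x - t)), hψdef]
    by_cases ht : t ∈ J
    · simp [hG, ht, hsub ht]
    · have := hψ0 t ht
      rw [hψdef] at this
      simp [this]
  calc ∫ x in a..b, |iteratedDeriv k
          (ψ ⋆[ContinuousLinearMap.lsmul ℝ ℝ, volume] (I.indicator u)) x - c|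
      ≤ ∫ x in a..b, (ψ ⋆[ContinuousLinearMap.lsmul ℝ ℝ, volume] G) x := by
        refine intervalIntegral.integral_mono_on hab ?_ hci.intervalIntegrable hpt
        exact (((hf.continuous_iteratedDeriv k (by exact_mod_cast le_top)).sub
          continuous_const).abs).intervalIntegrable _ _
    _ ≤ ∫ x, (ψ ⋆[ContinuousLinearMap.lsmul ℝ ℝ, volume] G) x := by
        rw [intervalIntegral.integral_of_le hab]
        exact setIntegral_le_integral hci (Eventually.of_forall hnn)
    _ = ∫ x in J, |g x - c| := by
        rw [integral_convolution _ hψi hGi, hψdef, φ.integral_normed, hG, integral_indicator hJm]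
        simp

/-- A function whose weak `k`-th derivative is close to a constant in `L¹` is close in measure to a
polynomial of degree at most `k`. -/
lemma IsWeakDeriv.exists_polynomial_measure_le {k : ℕ} {u g : ℝ → ℝ} {I : Set ℝ}
    (hI : MeasurableSet I) (h : IsWeakDeriv k u g I) (hu : IntegrableOn u I)
    (hg : IntegrableOn g I) {a b ρ : ℝ} (hab : a ≤ b) (hρ : 0 < ρ)
    (hsub : Ioo (a - ρ) (b + ρ) ⊆ I) (c : ℝ) {θ η : ℝ} (hθ : 0 < θ) (hη : 0 < η) :
    ∃ P : Polynomial ℝ, P.natDegree ≤ k ∧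
      volume {x ∈ Icc a b | η < |u x - P.eval x|} ≤
        ENNReal.ofReal (θ + (b - a) ^ k * (∫ x in Ioo (a - ρ) (b + ρ), |g x - c|) / (η / 2)) := by
  -- The outer radii tend to 0 and stay below `ρ`; the fixed ratio 2 of outer to inner radius gives
  -- a.e. convergence of the mollifications.
  let φ : ℕ → ContDiffBump (0 : ℝ) := fun n =>
    ⟨ρ / (2 * (n + 2)), ρ / (n + 2), by positivity, by
      rw [div_lt_div_iff₀ (by positivity) (by positivity)]; nlinarith⟩
  have hrOut : ∀ n, (φ n).rOut < ρ := fun n => by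
    change ρ / (n + 2) < ρ
    rw [div_lt_iff₀ (by positivity)]
    nlinarith [(n.cast_nonneg : (0 : ℝ) ≤ n)]
  have hu' : Integrable (I.indicator u) := hu.integrable_indicator hI
  set f : ℕ → ℝ → ℝ := fun n =>
    (φ n).normed volume ⋆[ContinuousLinearMap.lsmul ℝ ℝ, volume] (I.indicator u) with hfdef
  have hf : ∀ n, ContDiff ℝ ∞ (f n) := fun n =>
    (φ n).hasCompactSupport_normed.contDiff_convolution_left _ (φ n).contDiff_normed
      hu'.locallyIntegrable
  have hae : ∀ᵐ x, Tendsto (fun n => f n x) atTop (𝓝 (I.indicator u x)) := by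
    refine ContDiffBump.ae_convolution_tendsto_right_of_locallyIntegrable (K := 2) ?_ ?_
      hu'.locallyIntegrable
    · change Tendsto (fun n : ℕ => ρ / ((n : ℝ) + 2)) atTop (𝓝 0)
      exact tendsto_const_nhds.div_atTop
        (tendsto_atTop_add_const_right _ _ tendsto_natCast_atTop_atTop)
    · refine Eventually.of_forall fun n => le_of_eq ?_
      change ρ / (n + 2) = 2 * (ρ / (2 * (n + 2)))
      field_simp
  have hmeas : TendstoInMeasure (volume.restrict (Icc a b)) f atTop (I.indicator u) :=
    tendstoInMeasure_of_tendsto_ae (fun n => (hf n).continuous.aestronglyMeasurable)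
      (ae_restrict_of_ae hae)
  rw [tendstoInMeasure_iff_dist] at hmeas
  obtain ⟨n, hn⟩ := (((hmeas (η / 2) (by positivity)).eventually
    (gt_mem_nhds (ENNReal.ofReal_pos.mpr hθ)))).exists
  obtain ⟨P, hP, hPi⟩ := exists_polynomial_integral_le k (hf n) hab c
  refine ⟨P, hP, ?_⟩
  have hI' : Icc a b ⊆ I := fun x hx => hsub ⟨by linarith [hx.1], by linarith [hx.2]⟩
  have hle := hPi.trans (mul_le_mul_of_nonneg_left
    (h.integral_mollification_le hI hu hg (φ n) hab (hrOut n) hsub c)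
    (pow_nonneg (by linarith) k))
  -- The tolerance `η` is split evenly: Markov's inequality bounds `f n - P` at level `η / 2`, while
  -- `θ` pays for `u - f n`.
  have hM : volume {x ∈ Icc a b | η / 2 ≤ |f n x - P.eval x|} ≤
      ENNReal.ofReal ((b - a) ^ k * (∫ x in Ioo (a - ρ) (b + ρ), |g x - c|) / (η / 2)) := by
    have hcont : Continuous fun x => |f n x - P.eval x| :=
      ((hf n).continuous.sub P.continuous).abs
    have := mul_meas_ge_le_integral_of_nonneg (μ := volume.restrict (Icc a b))
      (f := fun x => |f n x - P.eval x|) (Eventually.of_forall fun x => abs_nonneg _)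
      (hcont.integrableOn_Icc) (η / 2)
    rw [integral_Icc_eq_integral_Ioc, ← intervalIntegral.integral_of_le hab] at this
    have h2 := this.trans hle
    rw [measureReal_def, Measure.restrict_apply' measurableSet_Icc] at h2
    rw [show {x | x ∈ Icc a b ∧ η / 2 ≤ |f n x - P.eval x|} =
      {x | η / 2 ≤ |f n x - P.eval x|} ∩ Icc a b by ext; simp [and_comm]]
    rw [ENNReal.le_ofReal_iff_toReal_le _ (by positivity), le_div_iff₀ (by positivity), mul_comm]
    · exact h2
    · exact ((measure_mono inter_subset_right).trans_lt measure_Icc_lt_top).ne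
  rw [ENNReal.ofReal_add hθ.le (by positivity)]
  refine le_trans (measure_mono (?_ : _ ⊆ {x | η / 2 ≤ dist (f n x) (I.indicator u x)} ∩ Icc a b ∪
    {x ∈ Icc a b | η / 2 ≤ |f n x - P.eval x|}))
    ((measure_union_le _ _).trans (add_le_add ?_ hM))
  · rintro x ⟨hx, hxη⟩
    by_cases h1 : η / 2 ≤ |f n x - P.eval x|
    · exact Or.inr ⟨hx, h1⟩
    · refine Or.inl ⟨?_, hx⟩
      push Not at h1
      rw [mem_ofPred_eq, indicator_of_mem (hI' hx), Real.dist_eq, abs_sub_comm]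
      have := abs_sub_le (u x) (f n x) (P.eval x)
      linarith
  · rw [← Measure.restrict_apply' measurableSet_Icc]
    exact hn.le

/-! ### Localized energy and Poincaré inequalities -/

/-- The squared Gagliardo `s`-seminorm of `g` on `J`, read as the squared `L²`-norm if `s = 0`. -/
noncomputable def gagliardoSq (s : ℝ) (g : ℝ → ℝ) (J : Set ℝ) : ℝ≥0∞ :=
  if s = 0 then
    ∫⁻ x in J, ENNReal.ofReal (|g x| ^ 2)
  else
    ∫⁻ z in J ×ˢ J, ENNReal.ofReal (|g z.1 - g z.2| ^ 2 / |z.1 - z.2| ^ (1 + 2 * s))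

/-- The energy of `u` with `k`-th derivative `g` on `J`. -/
noncomputable def localEnergy (W : ℝ → ℝ) (k : ℕ) (s ε : ℝ) (u g : ℝ → ℝ) (J : Set ℝ) : ℝ≥0∞ :=
  ENNReal.ofReal (1 / ε) * (∫⁻ x in J, ENNReal.ofReal (W (u x))) +
    ENNReal.ofReal (ε ^ (2 * ((k : ℝ) + s) - 1)) * gagliardoSq s g J

/-- Fixing the derivative `g` on the whole interval means that localizing changes only the domain of
integration, not the chosen representative. -/
lemma energy_eq_localEnergy (W : ℝ → ℝ) (k : ℕ) (s ε : ℝ) (u : ℝ → ℝ) (I : Set ℝ) :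
    energy W k s ε u I = localEnergy W k s ε u (weakDeriv k u I) I := rfl

lemma le_ofReal_div_of_mul_le {c δ : ℝ} (hc : 0 < c) {X : ℝ≥0∞}
    (h : ENNReal.ofReal c * X ≤ ENNReal.ofReal δ) : X ≤ ENNReal.ofReal (δ / c) := by
  rw [ENNReal.ofReal_div_of_pos hc, ENNReal.le_div_iff_mul_le, mul_comm]
  · exact h
  · left; simpa using hc
  · left; simp

/-- A Poincaré inequality with respect to the Gagliardo seminorm. -/
lemma exists_const_lintegral_sq_le {s : ℝ} (hs : 0 ≤ s) {g : ℝ → ℝ} {p q : ℝ} (hpq : p < q)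
    (hg : AEMeasurable g (volume.restrict (Ioo p q))) :
    ∃ c : ℝ, ∫⁻ x in Ioo p q, ENNReal.ofReal (|g x - c| ^ 2) ≤
      ENNReal.ofReal ((q - p) ^ (2 * s)) * gagliardoSq s g (Ioo p q) := by
  rcases eq_or_ne s 0 with rfl | hs0
  · exact ⟨0, by simp [gagliardoSq]⟩
  set J := Ioo p q with hJ
  set F : ℝ × ℝ → ℝ≥0∞ := fun z =>
    ENNReal.ofReal (|g z.1 - g z.2| ^ 2 / |z.1 - z.2| ^ (1 + 2 * s)) with hF
  have hqp : 0 < q - p := sub_pos.mpr hpq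
  have hvol : volume J = ENNReal.ofReal (q - p) := Real.volume_Ioo
  have hFm : AEMeasurable F ((volume.restrict J).prod (volume.restrict J)) := by
    have h1 : AEMeasurable (fun z : ℝ × ℝ => g z.1)
        ((volume.restrict J).prod (volume.restrict J)) :=
      hg.comp_quasiMeasurePreserving Measure.quasiMeasurePreserving_fst
    have h2 : AEMeasurable (fun z : ℝ × ℝ => g z.2)
        ((volume.restrict J).prod (volume.restrict J)) :=
      hg.comp_quasiMeasurePreserving Measure.quasiMeasurePreserving_snd
    have h3 : Measurable fun z : ℝ × ℝ => |z.1 - z.2| ^ (1 + 2 * s) := by fun_prop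
    exact (((h1.sub h2).abs.pow_const 2).div h3.aemeasurable).ennreal_ofReal
  have hprod : gagliardoSq s g J = ∫⁻ y in J, ∫⁻ x in J, F (y, x) := by
    rw [gagliardoSq, if_neg hs0, Measure.volume_eq_prod, ← Measure.prod_restrict,
      lintegral_prod _ hFm]
  -- Some slice of the double integral is at most the average over slices; `c` is the value of `g`
  -- at that slice. Bounding `|x - y|` by `q - p` costs `(q - p) ^ (1 + 2 * s)`, and the average
  -- gives back one power.
  obtain ⟨y, hy, hyle⟩ := exists_le_setLAverage (μ := volume) (s := J)
    (f := fun y => ∫⁻ x in J, F (y, x)) (by simp [hvol, hpq]) (by simp [hvol])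
    hFm.lintegral_prod_right'
  refine ⟨g y, ?_⟩
  have hpt : ∀ x ∈ J, ENNReal.ofReal (|g x - g y| ^ 2) ≤
      ENNReal.ofReal ((q - p) ^ (1 + 2 * s)) * F (y, x) := by
    intro x hx
    rw [hF, ← ENNReal.ofReal_mul (by positivity)]
    refine ENNReal.ofReal_le_ofReal ?_
    rcases eq_or_ne x y with rfl | hxy
    · simp
    have hpos : 0 < |y - x| := abs_pos.mpr (sub_ne_zero.mpr hxy.symm)
    have hle : |y - x| ≤ q - p := by
      rw [abs_le]; constructor <;> linarith [hx.1, hx.2, hy.1, hy.2]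
    have hrp : |y - x| ^ (1 + 2 * s) ≤ (q - p) ^ (1 + 2 * s) :=
      Real.rpow_le_rpow hpos.le hle (by linarith)
    have hrp0 : 0 < |y - x| ^ (1 + 2 * s) := Real.rpow_pos_of_pos hpos _
    rw [mul_div_assoc', le_div_iff₀ hrp0, abs_sub_comm (g x), mul_comm]
    exact mul_le_mul_of_nonneg_right hrp (by positivity)
  calc ∫⁻ x in J, ENNReal.ofReal (|g x - g y| ^ 2)
      ≤ ∫⁻ x in J, ENNReal.ofReal ((q - p) ^ (1 + 2 * s)) * F (y, x) :=
        setLIntegral_mono' measurableSet_Ioo hpt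
    _ = ENNReal.ofReal ((q - p) ^ (1 + 2 * s)) * ∫⁻ x in J, F (y, x) :=
        lintegral_const_mul' _ _ ENNReal.ofReal_ne_top
    _ ≤ ENNReal.ofReal ((q - p) ^ (1 + 2 * s)) *
        (gagliardoSq s g J / ENNReal.ofReal (q - p)) := by
        gcongr
        rwa [setLAverage_eq, ← hprod, hvol] at hyle
    _ = ENNReal.ofReal ((q - p) ^ (2 * s)) * gagliardoSq s g J := by
        have h0 : ENNReal.ofReal (q - p) ≠ 0 := by simpa using hpq
        rw [Real.rpow_add hqp, Real.rpow_one, ENNReal.ofReal_mul hqp.le, mul_comm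
          (ENNReal.ofReal (q - p)), mul_assoc, ENNReal.mul_div_cancel h0 ENNReal.ofReal_ne_top]

/-- Young's inequality with a free parameter replaces Cauchy–Schwarz and avoids square roots. The
constant `c` is chosen before `r`, which can later be tuned to the window size. -/
lemma exists_const_integral_abs_le {s : ℝ} (hs : 0 ≤ s) {g : ℝ → ℝ} {p q B : ℝ} (hpq : p < q)
    (hg : MemLp g 2 (volume.restrict (Ioo p q))) (hB : 0 ≤ B)
    (hgB : gagliardoSq s g (Ioo p q) ≤ ENNReal.ofReal B) :
    ∃ c : ℝ, ∀ r > 0, ∫ x in Ioo p q, |g x - c| ≤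
      r * (q - p) + r⁻¹ * ((q - p) ^ (2 * s) * B) := by
  obtain ⟨c, hc⟩ := exists_const_lintegral_sq_le hs hpq hg.aestronglyMeasurable.aemeasurable
  refine ⟨c, fun r hr => ?_⟩
  have hqp : 0 < q - p := sub_pos.mpr hpq
  have hgc : MemLp (fun x => g x - c) 2 (volume.restrict (Ioo p q)) := hg.sub (memLp_const c)
  have hi2 : Integrable (fun x => |g x - c| ^ 2) (volume.restrict (Ioo p q)) := by
    simpa using hgc.integrable_sq
  have hi1 : Integrable (fun x => |g x - c|) (volume.restrict (Ioo p q)) :=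
    (hgc.integrable (by norm_num)).abs
  have h2 : ∫ x in Ioo p q, |g x - c| ^ 2 ≤ (q - p) ^ (2 * s) * B := by
    rw [integral_eq_lintegral_of_nonneg_ae (Eventually.of_forall fun x => by positivity)
      hi2.aestronglyMeasurable]
    refine ENNReal.toReal_le_of_le_ofReal (by positivity) (hc.trans ?_)
    rw [ENNReal.ofReal_mul (by positivity)]
    gcongr
  calc ∫ x in Ioo p q, |g x - c| ≤ ∫ x in Ioo p q, (r + r⁻¹ * |g x - c| ^ 2) := by
        refine integral_mono hi1 ((integrable_const r).add (hi2.const_mul _)) fun x => ?_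
        change |g x - c| ≤ r + r⁻¹ * |g x - c| ^ 2
        have : r + r⁻¹ * |g x - c| ^ 2 = (r ^ 2 + |g x - c| ^ 2) / r := by field_simp
        rw [this, le_div_iff₀ hr]
        nlinarith [sq_nonneg (r - |g x - c|), abs_nonneg (g x - c)]
    _ = r * (q - p) + r⁻¹ * ∫ x in Ioo p q, |g x - c| ^ 2 := by
        rw [integral_add (integrable_const r) (hi2.const_mul _), integral_const_mul]
        simp [measureReal_def, hqp.le, mul_comm]
    _ ≤ _ := by gcongr

/-! ### A single window of length comparable to `ε` -/

/-- The set where `u` is far from both wells is controlled by the potential energy. -/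
lemma IsDoubleWell.measure_far_le {W : ℝ → ℝ} (hW : IsDoubleWell W) {τ : ℝ} (hτ : 0 < τ) :
    ∃ c > 0, ∀ (u : ℝ → ℝ) (J : Set ℝ), MeasurableSet J →
      AEMeasurable u (volume.restrict J) →
      ENNReal.ofReal c * volume {x ∈ J | τ ≤ |u x - 1| ∧ τ ≤ |u x + 1|} ≤
        ∫⁻ x in J, ENNReal.ofReal (W (u x)) := by
  obtain ⟨α, hα, β, hβ, hl⟩ := hW.lower
  refine ⟨α * min (τ ^ 2) β, by positivity, fun u J hJ hu => ?_⟩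
  refine le_trans ?_ (mul_meas_ge_le_lintegral₀
    ((hW.continuous.measurable.comp_aemeasurable hu).ennreal_ofReal)
    (ENNReal.ofReal (α * min (τ ^ 2) β)))
  refine mul_le_mul' le_rfl ?_
  rw [Measure.restrict_apply' hJ]
  refine measure_mono ?_
  rintro x ⟨hx, h1, h2⟩
  refine ⟨ENNReal.ofReal_le_ofReal ((mul_le_mul_of_nonneg_left ?_ hα.le).trans (hl (u x))), hx⟩
  refine min_le_min (le_min ?_ ?_) le_rfl
  · rw [← sq_abs (u x + 1)]; gcongr
  · rw [← sq_abs (u x - 1)]; gcongr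

/-- The exponent `2(k+s) - 1` in the energy is the one for which `k` integrations and the Poincaré
factor combine to `ε`, up to constants, so the resulting bound is proportional to the window length.
-/
lemma window_scaling (k : ℕ) {s ε h δ : ℝ} (hs0 : 0 ≤ s) (hs1 : s < 1) (hδ : 0 ≤ δ) (hh : 0 < h)
    (hhε : h ≤ ε) (hεh : ε ≤ 2 * h) :
    (h ^ k) ^ 2 * ((4 * h) ^ (2 * s) * (δ / ε ^ (2 * ((k : ℝ) + s) - 1))) ≤ 32 * δ * h := by
  have hε : 0 < ε := hh.trans_le hhε
  have hrp : 0 < ε ^ (2 * ((k : ℝ) + s) - 1) := Real.rpow_pos_of_pos hε _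
  have h4 : (4 : ℝ) ^ (2 * s) ≤ 16 := by
    calc (4 : ℝ) ^ (2 * s) ≤ 4 ^ (2 : ℝ) :=
          Real.rpow_le_rpow_of_exponent_le (by norm_num) (by linarith)
      _ = 16 := by norm_num
  have hpow : (h ^ k) ^ 2 * h ^ (2 * s) = h ^ (2 * ((k : ℝ) + s)) := by
    rw [← pow_mul, ← Real.rpow_natCast, ← Real.rpow_add hh]
    congr 1
    push_cast
    ring
  have hmono : h ^ (2 * ((k : ℝ) + s)) ≤ ε ^ (2 * ((k : ℝ) + s)) :=
    Real.rpow_le_rpow hh.le hhε (by positivity)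
  have hεpow : ε ^ (2 * ((k : ℝ) + s)) = ε ^ (2 * ((k : ℝ) + s) - 1) * ε := by
    rw [← Real.rpow_add_one hε.ne']
    congr 1
    ring
  set B : ℝ := δ / ε ^ (2 * ((k : ℝ) + s) - 1) with hB
  have hB0 : 0 ≤ B := by positivity
  calc (h ^ k) ^ 2 * ((4 * h) ^ (2 * s) * B)
      = 4 ^ (2 * s) * h ^ (2 * ((k : ℝ) + s)) * B := by
        rw [Real.mul_rpow (by norm_num) hh.le, ← hpow]; ring
    _ ≤ 16 * (ε ^ (2 * ((k : ℝ) + s) - 1) * ε) * B := by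
        rw [← hεpow]
        gcongr
    _ = 16 * δ * ε := by rw [hB]; field_simp
    _ ≤ 32 * δ * h := by nlinarith

/-- A function close both to a polynomial and to `{-1, 1}` off a set of small measure is close to
one of the wells there. -/
lemma exists_sign_of_close_to_polynomial {k : ℕ} {P : Polynomial ℝ} (hP : P.natDegree ≤ k)
    {a L τ : ℝ} (hL : 0 < L) {E : Set ℝ} (hE : volume E < ENNReal.ofReal (L / (4 * k + 1)))
    (hτ : τ ≤ 1 / 16) (hκ : (2 * k + 1) * (4 * k + 1) ^ (2 * k) * (8 * τ) < 1) {u : ℝ → ℝ}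
    (h : ∀ x ∈ Icc a (a + L), x ∉ E →
      |u x - P.eval x| ≤ τ ∧ (|u x - 1| < τ ∨ |u x + 1| < τ)) :
    ∃ σ : ℝ, (σ = 1 ∨ σ = -1) ∧ ∀ x ∈ Icc a (a + L), x ∉ E → |u x - σ| ≤ 1 / 2 := by
  -- `P` is within `2τ` of a well, so `|P ^ 2 - 1| ≤ 2τ(2 + 2τ) ≤ 8τ`.
  have hsq : ∀ x ∈ Icc a (a + L), x ∉ E → |P.eval x ^ 2 - 1| ≤ 8 * τ := by
    intro x hx hxE
    obtain ⟨h1, h2⟩ := h x hx hxE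
    have h1' := abs_le.mp h1
    rcases h2 with h2 | h2 <;> have h2' := abs_lt.mp h2 <;> rw [abs_le] <;> constructor <;>
      nlinarith
  rcases polynomial_constant_sign hP hL hE hκ hsq with hpos | hneg
  · refine ⟨1, Or.inl rfl, fun x hx hxE => ?_⟩
    obtain ⟨h1, h2⟩ := h x hx hxE
    have := hpos x hx
    have h1' := abs_le.mp h1
    rcases h2 with h2 | h2
    · linarith
    · have h2' := abs_lt.mp h2
      linarith
  · refine ⟨-1, Or.inr rfl, fun x hx hxE => ?_⟩
    obtain ⟨h1, h2⟩ := h x hx hxE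
    have := hneg x hx
    have h1' := abs_le.mp h1
    rcases h2 with h2 | h2
    · have h2' := abs_lt.mp h2
      linarith
    · rw [sub_neg_eq_add]; linarith

/-- On a window of size comparable to `ε` with small energy, `u` is close to one of the wells
off a set of small measure. -/
lemma exists_sign_of_localEnergy_le {W : ℝ → ℝ} (hW : IsDoubleWell W) (k : ℕ) {s : ℝ}
    (hs0 : 0 ≤ s) (hs1 : s < 1) {θ : ℝ} (hθ : 0 < θ) :
    ∃ δ > 0, ∀ (ε h a : ℝ) (u g : ℝ → ℝ) (I : Set ℝ), 0 < h → h ≤ ε → ε ≤ 2 * h →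
      MeasurableSet I → Ioo (a - h) (a + 3 * h) ⊆ I → IsWeakDeriv k u g I → IntegrableOn u I →
      IntegrableOn g I → MemLp g 2 (volume.restrict I) →
      localEnergy W k s ε u g (Ioo (a - h) (a + 3 * h)) ≤ ENNReal.ofReal δ →
      ∃ σ : ℝ, (σ = 1 ∨ σ = -1) ∧
        volume {x ∈ Icc a (a + 2 * h) | 1 / 2 < |u x - σ|} ≤ ENNReal.ofReal (θ * h) := by
  set K : ℝ := (2 * k + 1) * (4 * k + 1) ^ (2 * k) with hK
  have hk0 : (0 : ℝ) ≤ k := k.cast_nonneg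
  have hK1 : 1 ≤ K := by
    have h1 : (1 : ℝ) ≤ (4 * k + 1) ^ (2 * k) := one_le_pow₀ (by linarith)
    nlinarith
  -- Chosen so that `K * (8 * τ) = 1 / 2`, which leaves room in the sign criterion.
  set τ : ℝ := 1 / (16 * K) with hτdef
  have hτ : 0 < τ := by positivity
  have hτK : K * (8 * τ) = 1 / 2 := by rw [hτdef]; field_simp; norm_num
  have hτ1 : τ ≤ 1 / 16 := by nlinarith
  set ϑ : ℝ := min θ (1 / (4 * k + 1)) with hϑ
  have hϑ0 : 0 < ϑ := by positivity
  obtain ⟨c₀, hc₀, hfar⟩ := hW.measure_far_le hτ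
  -- `m / h ^ k` will be the Young parameter. With `m` and the second entry of `δ`, both terms of
  -- the `L¹` bound contribute `ϑ * τ / 16` per unit of `h`; the first entry of `δ` handles the
  -- potential.
  set m : ℝ := ϑ * τ / (2 ^ k * 64) with hm
  have hm0 : 0 < m := by positivity
  set δ : ℝ := min (ϑ * c₀ / 4) (ϑ * τ * m / (2 ^ k * 512)) with hδ
  have hδ0 : 0 < δ := by positivity
  refine ⟨δ, hδ0, fun ε h a u g I hh hhε hεh hI hJI hw hu hg hg2 hE => ?_⟩
  set J := Ioo (a - h) (a + 3 * h) with hJ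
  have hε : 0 < ε := hh.trans_le hhε
  have hrp : 0 < ε ^ (2 * ((k : ℝ) + s) - 1) := Real.rpow_pos_of_pos hε _
  have hE1 := le_ofReal_div_of_mul_le (by positivity) (le_self_add.trans hE)
  have hE2 := le_ofReal_div_of_mul_le hrp (le_add_self.trans hE)
  have hIcc : Icc a (a + 2 * h) ⊆ J := fun x hx => ⟨by linarith [hx.1], by linarith [hx.2]⟩
  set B : ℝ := δ / ε ^ (2 * ((k : ℝ) + s) - 1) with hB
  have hB0 : 0 ≤ B := by positivity
  obtain ⟨c, hc⟩ := exists_const_integral_abs_le hs0 (p := a - h) (q := a + 3 * h) (by linarith)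
    (hg2.mono_measure (Measure.restrict_mono hJI le_rfl)) hB0 hE2
  have hlen : a + 3 * h - (a - h) = 4 * h := by ring
  rw [hlen] at hc
  have hscale := window_scaling k hs0 hs1 hδ0.le hh hhε hεh
  have hhk : 0 < h ^ k := pow_pos hh k
  have hA : (2 * h) ^ k * (∫ x in J, |g x - c|) / (τ / 2) ≤ ϑ * h / 4 := by
    have h1 := hc (m / h ^ k) (by positivity)
    have h2 : h ^ k * ∫ x in J, |g x - c| ≤ 4 * m * h + 32 * δ * h / m := by
      calc h ^ k * ∫ x in J, |g x - c|
          ≤ h ^ k * (m / h ^ k * (4 * h) + (m / h ^ k)⁻¹ * ((4 * h) ^ (2 * s) * B)) := by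
            gcongr
        _ = 4 * m * h + ((h ^ k) ^ 2 * ((4 * h) ^ (2 * s) * B)) / m := by
            field_simp
        _ ≤ _ := by gcongr
    have h3 : δ ≤ ϑ * τ * m / (2 ^ k * 512) := min_le_right _ _
    have h4 : 2 ^ k * (32 * δ / m) ≤ ϑ * τ / 16 := by
      calc 2 ^ k * (32 * δ / m) ≤ 2 ^ k * (32 * (ϑ * τ * m / (2 ^ k * 512)) / m) := by gcongr
        _ = ϑ * τ / 16 := by field_simp; norm_num
    have h5 : 2 ^ k * (4 * m) = ϑ * τ / 16 := by rw [hm]; field_simp; norm_num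
    rw [div_le_iff₀ (by positivity), mul_pow]
    calc 2 ^ k * h ^ k * ∫ x in J, |g x - c| = 2 ^ k * (h ^ k * ∫ x in J, |g x - c|) := by ring
      _ ≤ 2 ^ k * (4 * m * h + 32 * δ * h / m) := by gcongr
      _ = (2 ^ k * (4 * m) + 2 ^ k * (32 * δ / m)) * h := by ring
      _ ≤ (ϑ * τ / 16 + ϑ * τ / 16) * h := by rw [h5]; gcongr
      _ = _ := by ring
  obtain ⟨P, hP, hPm⟩ := hw.exists_polynomial_measure_le hI hu hg (a := a) (b := a + 2 * h)
    (ρ := h) (by linarith) hh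
    (by rw [show a + 2 * h + h = a + 3 * h by ring]; exact hJI) c
    (θ := ϑ * h / 4) (by positivity) hτ
  rw [show a + 2 * h + h = a + 3 * h by ring, show a + 2 * h - a = 2 * h by ring] at hPm
  have hPm' : volume {x ∈ Icc a (a + 2 * h) | τ < |u x - P.eval x|} ≤
      ENNReal.ofReal (ϑ * h / 2) :=
    hPm.trans (ENNReal.ofReal_le_ofReal (by linarith))
  have hWm : volume {x ∈ J | τ ≤ |u x - 1| ∧ τ ≤ |u x + 1|} ≤ ENNReal.ofReal (ϑ * h / 2) := by
    have h1 := hfar u J measurableSet_Ioo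
      (hu.aestronglyMeasurable.aemeasurable.mono_measure (Measure.restrict_mono hJI le_rfl))
    refine (le_ofReal_div_of_mul_le hc₀ (h1.trans hE1)).trans (ENNReal.ofReal_le_ofReal ?_)
    have h3 : δ ≤ ϑ * c₀ / 4 := min_le_left _ _
    rw [div_div_eq_mul_div, div_one, div_le_iff₀ hc₀]
    calc δ * ε ≤ (ϑ * c₀ / 4) * (2 * h) := by gcongr
      _ = _ := by ring
  set E : Set ℝ := {x ∈ Icc a (a + 2 * h) | τ < |u x - P.eval x|} ∪
    {x ∈ J | τ ≤ |u x - 1| ∧ τ ≤ |u x + 1|} with hEdef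
  have hEm : volume E ≤ ENNReal.ofReal (ϑ * h) := by
    refine (measure_union_le _ _).trans ((add_le_add hPm' hWm).trans (le_of_eq ?_))
    rw [← ENNReal.ofReal_add (by positivity) (by positivity)]
    congr 1
    ring
  have hoff : ∀ x ∈ Icc a (a + 2 * h), x ∉ E →
      |u x - P.eval x| ≤ τ ∧ (|u x - 1| < τ ∨ |u x + 1| < τ) := by
    intro x hx hxE
    simp only [hEdef, mem_union, mem_ofPred_eq, not_or, not_and, not_lt, not_le] at hxE
    refine ⟨hxE.1 hx, ?_⟩
    by_contra! hcon
    exact absurd (hxE.2 (hIcc hx) hcon.1) (not_lt.mpr hcon.2)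
  have hEm' : volume E < ENNReal.ofReal (2 * h / (4 * k + 1)) := by
    refine hEm.trans_lt ((ENNReal.ofReal_lt_ofReal_iff (by positivity)).mpr ?_)
    have h1 : ϑ ≤ 1 / (4 * k + 1) := min_le_right _ _
    calc ϑ * h ≤ 1 / (4 * k + 1) * h := by gcongr
      _ < 2 * h / (4 * k + 1) := by
        rw [div_mul_eq_mul_div, one_mul]
        gcongr
        linarith
  obtain ⟨σ, hσ, hσE⟩ := exists_sign_of_close_to_polynomial hP (by positivity) hEm' hτ1
    (by linarith) hoff
  refine ⟨σ, hσ, (measure_mono ?_).trans (hEm.trans (ENNReal.ofReal_le_ofReal ?_))⟩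
  · rintro x ⟨hx, hxσ⟩
    by_contra hxE
    exact absurd (hσE x hx hxE) (not_le.mpr hxσ)
  · exact mul_le_mul_of_nonneg_right (min_le_left _ _) hh.le

/-! ### Covering by windows and counting the expensive ones -/

/-- Sets that overlap at most `m` times: the integrals over them add up to at most `m` times the
integral over their union. -/
lemma sum_setLIntegral_le_of_overlap {α ι : Type*} [MeasurableSpace α] {μ : Measure α}
    (V : Finset ι) {A : ι → Set α} {B : Set α} (hA : ∀ i, MeasurableSet (A i))
    (hB : MeasurableSet B) (hAB : ∀ i ∈ V, A i ⊆ B) {m : ℕ}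
    (hm : ∀ x ∈ B, ∃ T : Finset ι, T.card ≤ m ∧ ∀ i ∈ V, x ∈ A i → i ∈ T) (f : α → ℝ≥0∞) :
    ∑ i ∈ V, ∫⁻ x in A i, f x ∂μ ≤ m * ∫⁻ x in B, f x ∂μ := by
  classical
  rw [← lintegral_finsetSum_measure, ← smul_eq_mul, ← lintegral_smul_measure]
  -- Comparing the restricted measures themselves requires no measurability of `f`.
  refine lintegral_mono' (Measure.le_iff.mpr fun s hs => ?_) le_rfl
  rw [Measure.finsetSum_apply, Measure.smul_apply, smul_eq_mul, Measure.restrict_apply hs]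
  calc ∑ i ∈ V, μ.restrict (A i) s
      = ∑ i ∈ V, ∫⁻ x in s ∩ B, (A i).indicator 1 x ∂μ := by
        refine Finset.sum_congr rfl fun i hi => ?_
        rw [lintegral_indicator_one (hA i), Measure.restrict_apply hs,
          Measure.restrict_apply (hA i)]
        congr 1
        ext x
        simp only [mem_inter_iff]
        exact ⟨fun h => ⟨h.2, h.1, hAB i hi h.2⟩, fun h => ⟨h.2.1, h.1⟩⟩
    _ = ∫⁻ x in s ∩ B, ∑ i ∈ V, (A i).indicator 1 x ∂μ :=
        (lintegral_finsetSum _ fun i _ => measurable_one.indicator (hA i)).symm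
    _ ≤ ∫⁻ _x in s ∩ B, (m : ℝ≥0∞) ∂μ := by
        refine setLIntegral_mono' (hs.inter hB) fun x hx => ?_
        obtain ⟨T, hT, hVT⟩ := hm x hx.2
        simp only [indicator_apply, Pi.one_apply]
        rw [Finset.sum_boole]
        refine Nat.cast_le.mpr ((Finset.card_le_card fun i hi => ?_).trans hT)
        exact hVT i (Finset.mem_filter.mp hi).1 (Finset.mem_filter.mp hi).2
    _ = m * μ (s ∩ B) := by simp

/-- The `j`-th enlarged window of size `h`. -/
def window (h : ℝ) (j : ℕ) : Set ℝ := Ioo (j * h - h) (j * h + 3 * h)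

lemma window_subset {N j : ℕ} {h : ℝ} (hh : 0 < h) (hN : N * h = 1)
    (hj : j ∈ Finset.Icc 1 (N - 3)) : window h j ⊆ Ioo 0 1 := by
  have hj' := Finset.mem_Icc.mp hj
  have h1 : (1 : ℝ) ≤ j := by exact_mod_cast hj'.1
  have h2 : (j : ℝ) + 3 ≤ N := by
    have : j + 3 ≤ N := by omega
    exact_mod_cast this
  intro x hx
  constructor
  · nlinarith [hx.1]
  · nlinarith [hx.2]

/-- A window has length `4 * h` and left endpoints are spaced by `h`, so only the indices from `n -
2` to `n + 1` can occur. -/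
lemma window_overlap {h : ℝ} (hh : 0 < h) {x : ℝ} (hx : 0 ≤ x) :
    ∃ T : Finset ℕ, T.card ≤ 4 ∧ ∀ j : ℕ, x ∈ window h j → j ∈ T := by
  set n := ⌊x / h⌋₊
  refine ⟨Finset.Ico (n - 2) (n + 2), by rw [Nat.card_Ico]; omega, fun j hj => ?_⟩
  have h1 : (n : ℝ) ≤ x / h := Nat.floor_le (by positivity)
  have h2 : x / h < n + 1 := Nat.lt_floor_add_one _
  rw [le_div_iff₀ hh] at h1
  rw [div_lt_iff₀ hh] at h2
  have h3 : (j : ℝ) < n + 2 := by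
    by_contra! hcon
    nlinarith [hj.1]
  have h4 : (n : ℝ) < j + 3 := by
    by_contra! hcon
    nlinarith [hj.2]
  have h3' : j < n + 2 := by exact_mod_cast h3
  have h4' : n < j + 3 := by exact_mod_cast h4
  rw [Finset.mem_Ico]
  omega

/-- The nonlocal term is superadditive: interactions between different windows are discarded, and
the squares `window × window` inherit the fourfold overlap from their first coordinate. -/
lemma sum_localEnergy_le (W : ℝ → ℝ) (k : ℕ) (s ε : ℝ) (u g : ℝ → ℝ) {N : ℕ} {h : ℝ}
    (hh : 0 < h) (hN : N * h = 1) :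
    ∑ j ∈ Finset.Icc 1 (N - 3), localEnergy W k s ε u g (window h j) ≤
      4 * localEnergy W k s ε u g (Ioo 0 1) := by
  have hm : ∀ j, MeasurableSet (window h j) := fun j => measurableSet_Ioo
  have h1 : ∀ f : ℝ → ℝ≥0∞, ∑ j ∈ Finset.Icc 1 (N - 3), ∫⁻ x in window h j, f x ≤
      (4 : ℕ) * ∫⁻ x in Ioo 0 1, f x := fun f =>
    sum_setLIntegral_le_of_overlap _ hm measurableSet_Ioo
      (fun j hj => window_subset hh hN hj) (fun x hx => by
        obtain ⟨T, hT, hT'⟩ := window_overlap hh hx.1.le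
        exact ⟨T, hT, fun j _ hj => hT' j hj⟩) f
  have h2 : ∑ j ∈ Finset.Icc 1 (N - 3), gagliardoSq s g (window h j) ≤
      (4 : ℕ) * gagliardoSq s g (Ioo 0 1) := by
    by_cases hs : s = 0
    · simp only [gagliardoSq, if_pos hs]
      exact h1 _
    · simp only [gagliardoSq, if_neg hs]
      exact sum_setLIntegral_le_of_overlap _ (fun j => (hm j).prod (hm j))
        (measurableSet_Ioo.prod measurableSet_Ioo)
        (fun j hj => prod_mono (window_subset hh hN hj) (window_subset hh hN hj))
        (fun x hx => by
          obtain ⟨T, hT, hT'⟩ := window_overlap hh hx.1.1.le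
          exact ⟨T, hT, fun j _ hj => hT' j hj.1⟩) _
  simp only [localEnergy, Finset.sum_add_distrib, ← Finset.mul_sum]
  calc _ ≤ ENNReal.ofReal (1 / ε) * ((4 : ℕ) * ∫⁻ x in Ioo 0 1, ENNReal.ofReal (W (u x))) +
        ENNReal.ofReal (ε ^ (2 * ((k : ℝ) + s) - 1)) * ((4 : ℕ) * gagliardoSq s g (Ioo 0 1)) :=
        add_le_add (mul_le_mul' le_rfl (h1 _)) (mul_le_mul' le_rfl h2)
    _ = _ := by push_cast; ring

open Classical in
/-- Few windows carry a large energy. -/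
lemma card_high_energy_le (W : ℝ → ℝ) (k : ℕ) (s ε : ℝ) (u g : ℝ → ℝ) {N : ℕ} {h : ℝ}
    (hh : 0 < h) (hN : N * h = 1) {S : ℝ≥0} (hS : localEnergy W k s ε u g (Ioo 0 1) ≤ S)
    {δ : ℝ} (hδ : 0 < δ) :
    ((((Finset.Icc 1 (N - 3)).filter fun j =>
      ¬ localEnergy W k s ε u g (window h j) ≤ ENNReal.ofReal δ).card : ℕ) : ℝ) ≤ 4 * S / δ := by
  set H := (Finset.Icc 1 (N - 3)).filter fun j =>
      ¬ localEnergy W k s ε u g (window h j) ≤ ENNReal.ofReal δ with hH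
  have h1 : (H.card : ℝ≥0∞) * ENNReal.ofReal δ ≤ 4 * S := by
    calc (H.card : ℝ≥0∞) * ENNReal.ofReal δ = ∑ _j ∈ H, ENNReal.ofReal δ := by simp
      _ ≤ ∑ j ∈ H, localEnergy W k s ε u g (window h j) :=
          Finset.sum_le_sum fun j hj => (not_le.mp (Finset.mem_filter.mp hj).2).le
      _ ≤ ∑ j ∈ Finset.Icc 1 (N - 3), localEnergy W k s ε u g (window h j) :=
          Finset.sum_le_sum_of_subset (Finset.filter_subset _ _)
      _ ≤ 4 * localEnergy W k s ε u g (Ioo 0 1) := sum_localEnergy_le W k s ε u g hh hN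
      _ ≤ 4 * S := by gcongr
  rw [le_div_iff₀ hδ]
  have h2 := ENNReal.toReal_mono (by finiteness) h1
  simpa [ENNReal.toReal_mul, hδ.le] using h2

/-! ### Signs of windows and step functions -/

/-- `u` cannot be close to both wells on most of an interval. -/
lemma not_close_to_both {u : ℝ → ℝ} {p q m₁ m₂ : ℝ} {J₁ J₂ : Set ℝ} (h₁ : Icc p q ⊆ J₁)
    (h₂ : Icc p q ⊆ J₂) (hm₁ : 0 ≤ m₁) (hm₂ : 0 ≤ m₂) (hm : m₁ + m₂ < q - p)
    (hJ₁ : volume {x ∈ J₁ | 1 / 2 < |u x - 1|} ≤ ENNReal.ofReal m₁)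
    (hJ₂ : volume {x ∈ J₂ | 1 / 2 < |u x - (-1)|} ≤ ENNReal.ofReal m₂) : False := by
  have hsub : Icc p q ⊆ {x ∈ J₁ | 1 / 2 < |u x - 1|} ∪ {x ∈ J₂ | 1 / 2 < |u x - (-1)|} := by
    intro x hx
    by_contra hcon
    simp only [mem_union, mem_ofPred_eq, not_or, not_and, not_lt] at hcon
    have a1 := abs_le.mp (hcon.1 (h₁ hx))
    have a2 := abs_le.mp (hcon.2 (h₂ hx))
    linarith
  have := (measure_mono hsub).trans ((measure_union_le _ _).trans (add_le_add hJ₁ hJ₂))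
  rw [Real.volume_Icc, ← ENNReal.ofReal_add hm₁ hm₂,
    ENNReal.ofReal_le_ofReal_iff (by positivity)] at this
  linarith

open Classical in
/-- The well to which `u` is close on most of the `j`-th window. -/
noncomputable def windowSign (u : ℝ → ℝ) (h : ℝ) (j : ℕ) : ℝ :=
  if volume {x ∈ Icc (j * h) (j * h + 2 * h) | 1 / 2 < |u x - 1|} ≤ ENNReal.ofReal (h / 4)
  then 1 else -1

lemma windowSign_eq (u : ℝ → ℝ) (h : ℝ) (j : ℕ) :
    windowSign u h j = 1 ∨ windowSign u h j = -1 := by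
  unfold windowSign
  split_ifs <;> simp

/-- The sign is defined with the threshold `h / 4`, yet it serves every `θ ≤ 1/4`: closeness to the
other well would leave part of the window close to both. This makes the step function below
independent of `θ`. -/
lemma windowSign_spec {u : ℝ → ℝ} {h : ℝ} (hh : 0 < h) {j : ℕ} {θ : ℝ} (hθ : 0 ≤ θ)
    (hθ' : θ ≤ 1 / 4)
    (hex : ∃ σ : ℝ, (σ = 1 ∨ σ = -1) ∧
      volume {x ∈ Icc (j * h) (j * h + 2 * h) | 1 / 2 < |u x - σ|} ≤ ENNReal.ofReal (θ * h)) :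
    volume {x ∈ Icc (j * h) (j * h + 2 * h) | 1 / 2 < |u x - windowSign u h j|} ≤
      ENNReal.ofReal (θ * h) := by
  obtain ⟨σ, rfl | rfl, hσ⟩ := hex
  · rwa [windowSign, if_pos (hσ.trans (ENNReal.ofReal_le_ofReal (by nlinarith)))]
  · rw [windowSign, if_neg]
    · exact hσ
    · intro hcon
      exact not_close_to_both (p := j * h) (q := j * h + 2 * h) subset_rfl subset_rfl
        (by positivity) (by positivity) (by nlinarith) hcon hσ

/-- Consecutive cores share an interval of length `h`, while the two exceptional sets fill at most
`h / 2`. -/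
lemma windowSign_succ {u : ℝ → ℝ} {h : ℝ} (hh : 0 < h) {j : ℕ}
    (h₁ : volume {x ∈ Icc (j * h) (j * h + 2 * h) | 1 / 2 < |u x - windowSign u h j|} ≤
      ENNReal.ofReal (1 / 4 * h))
    (h₂ : volume {x ∈ Icc ((j + 1 : ℕ) * h) ((j + 1 : ℕ) * h + 2 * h) |
      1 / 2 < |u x - windowSign u h (j + 1)|} ≤ ENNReal.ofReal (1 / 4 * h)) :
    windowSign u h j = windowSign u h (j + 1) := by
  have s1 : Icc (((j + 1 : ℕ) : ℝ) * h) ((j + 1 : ℕ) * h + h) ⊆ Icc (j * h) (j * h + 2 * h) := by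
    push_cast
    exact Icc_subset_Icc (by nlinarith) (by nlinarith)
  have s2 : Icc (((j + 1 : ℕ) : ℝ) * h) ((j + 1 : ℕ) * h + h) ⊆
      Icc ((j + 1 : ℕ) * h) ((j + 1 : ℕ) * h + 2 * h) :=
    Icc_subset_Icc le_rfl (by linarith)
  rcases windowSign_eq u h j with e1 | e1 <;> rcases windowSign_eq u h (j + 1) with e2 | e2 <;>
    rw [e1] at h₁ <;> rw [e2] at h₂ <;> rw [e1, e2]
  · exact (not_close_to_both s1 s2 (by positivity) (by positivity) (by nlinarith) h₁ h₂).elim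
  · exact (not_close_to_both s2 s1 (by positivity) (by positivity) (by nlinarith) h₂ h₁).elim

/-- The step function with initial value `σ` that changes sign at each of the points `t i`. -/
noncomputable def signStep {M : ℕ} (σ : ℝ) (t : Fin M → ℝ) (x : ℝ) : ℝ :=
  σ * ∏ i, if t i ≤ x then -1 else 1

open Classical in
lemma sign_sequence_eq {σ : ℕ → ℝ} (hσ : ∀ j, σ j = 1 ∨ σ j = -1) {N m : ℕ} (hm : m ≤ N) :
    σ m = σ 0 * ∏ j ∈ (Finset.range N).filter (fun j => σ j ≠ σ (j + 1)),
      if j < m then -1 else 1 := by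
  have h1 : ∀ m, σ m = σ 0 * ∏ j ∈ Finset.range m, if σ j ≠ σ (j + 1) then (-1 : ℝ) else 1 := by
    intro m
    induction m with
    | zero => simp
    | succ m ih =>
      rw [Finset.prod_range_succ, ← mul_assoc, ← ih]
      rcases hσ m with h | h <;> rcases hσ (m + 1) with h' | h' <;> rw [h, h'] <;> norm_num
  conv_lhs => rw [h1 m]
  congr 1
  rw [← Finset.prod_filter, ← Finset.prod_filter, Finset.filter_filter]
  refine Finset.prod_congr ?_ fun _ _ => rfl
  ext j
  simp only [Finset.mem_filter, Finset.mem_range]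
  exact ⟨fun h => ⟨by omega, h.2, h.1⟩, fun h => ⟨h.2.2, h.2.1⟩⟩

/-- Missing jumps are padded with dummy points at 2, invisible for `x < 2`, so that all step
functions have the same finite-dimensional parameter space. -/
lemma exists_fin_prod_eq {ι : Type*} (D : Finset ι) (T : ι → ℝ) (hT : ∀ j ∈ D, T j ∈ Icc (0 : ℝ) 2)
    {M : ℕ} (hM : D.card ≤ M) :
    ∃ t : Fin M → ℝ, (∀ i, t i ∈ Icc (0 : ℝ) 2) ∧ ∀ x < 2,
      ∏ j ∈ D, (if T j ≤ x then (-1 : ℝ) else 1) = ∏ i, if t i ≤ x then -1 else 1 := by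
  classical
  induction D using Finset.induction_on generalizing M with
  | empty => exact ⟨fun _ => 2, by simp, fun x hx => by simp [not_le.mpr hx]⟩
  | insert a D ha ih =>
    rw [Finset.card_insert_of_notMem ha] at hM
    obtain ⟨M, rfl⟩ : ∃ M', M = M' + 1 := ⟨M - 1, by omega⟩
    obtain ⟨t, ht, htx⟩ := ih (fun j hj => hT j (Finset.mem_insert_of_mem hj))
      (by omega : D.card ≤ M)
    refine ⟨Fin.cons (T a) t, fun i => ?_, fun x hx => ?_⟩
    · refine Fin.cases ?_ (fun i => ?_) i
      · simpa using hT a (Finset.mem_insert_self _ _)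
      · simpa using ht i
    · rw [Finset.prod_insert ha, Fin.prod_univ_succ, htx x hx]
      simp

/-! ### Approximation by step functions -/

/-- Weak derivatives are unique up to null sets. -/
lemma IsWeakDeriv.ae_eq {l : ℕ} {u g₁ g₂ : ℝ → ℝ} {I : Set ℝ} (hI : IsOpen I)
    (h₁ : IsWeakDeriv l u g₁ I) (h₂ : IsWeakDeriv l u g₂ I) :
    g₁ =ᵐ[volume.restrict I] g₂ := by
  have hli : LocallyIntegrableOn (fun x => g₁ x - g₂ x) I := h₁.2.1.sub h₂.2.1
  have hint : ∀ g : ℝ → ℝ, LocallyIntegrableOn g I → ∀ φ : ℝ → ℝ, Continuous φ →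
      HasCompactSupport φ → tsupport φ ⊆ I → IntegrableOn (fun x => g x * φ x) I := by
    intro g hg φ hφ hc hs
    obtain ⟨B, hB⟩ := hφ.bounded_above_of_compact_support hc
    have h1 : IntegrableOn (fun x => g x * φ x) (tsupport φ) :=
      (hg.integrableOn_compact_subset hs hc).mul_bdd hφ.aestronglyMeasurable
        (Eventually.of_forall hB)
    refine ((integrableOn_iff_integrable_of_support_subset ?_).mp h1).integrableOn
    intro x hx
    exact subset_tsupport φ (right_ne_zero_of_mul hx)
  have h := hI.ae_eq_zero_of_integral_contDiff_smul_eq_zero (μ := volume) hli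
    fun φ hφ hc hs => by
      have e1 := h₁.2.2 φ hφ hc hs
      have e2 := h₂.2.2 φ hφ hc hs
      have e3 := mul_left_cancel₀ (pow_ne_zero l (by norm_num : (-1 : ℝ) ≠ 0)) (e1.symm.trans e2)
      have e4 : ∫ x, φ x • (g₁ x - g₂ x) = ∫ x in I, φ x • (g₁ x - g₂ x) := by
        rw [setIntegral_eq_integral_of_forall_compl_eq_zero]
        intro x hx
        rw [image_eq_zero_of_notMem_tsupport (fun h => hx (hs h)), zero_smul]
      rw [e4]
      have e5 : ∀ x, φ x • (g₁ x - g₂ x) = g₁ x * φ x - g₂ x * φ x := fun x => by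
        rw [smul_eq_mul]; ring
      simp only [e5]
      rw [integral_sub (hint g₁ h₁.2.1 φ hφ.continuous hc hs)
        (hint g₂ h₂.2.1 φ hφ.continuous hc hs), e3, sub_self]
  rw [Filter.EventuallyEq, ae_restrict_iff' hI.measurableSet]
  filter_upwards [h] with x hx hxI
  exact sub_eq_zero.mp (hx hxI)

/-- `weakDeriv` is an arbitrary choice; its square integrability is inherited from the `L²`
derivative by a.e. uniqueness. -/
lemma MemH.weakDeriv_spec {k : ℕ} {u : ℝ → ℝ} {I : Set ℝ} (hI : IsOpen I) (hu : MemH k u I) :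
    IsWeakDeriv k u (weakDeriv k u I) I ∧ MemLp (weakDeriv k u I) 2 (volume.restrict I) := by
  obtain ⟨g, hg, hg2⟩ := hu.2 k le_rfl
  have hex : ∃ g, IsWeakDeriv k u g I := ⟨g, hg⟩
  have hspec : IsWeakDeriv k u (weakDeriv k u I) I := by
    rw [weakDeriv, dif_pos hex]
    exact Classical.choose_spec hex
  exact ⟨hspec, hg2.ae_eq (hg.ae_eq hI hspec)⟩

/-- Functions of bounded energy are close in measure to step functions with values in `{-1, 1}`
and a bounded number of jumps. -/
lemma exists_signStep_close {W : ℝ → ℝ} (hW : IsDoubleWell W) (k : ℕ) {s : ℝ}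
    (hs0 : 0 ≤ s) (hs1 : s < 1) (S : ℝ≥0) :
    ∃ (M : ℕ) (C : ℝ → ℝ), ∀ (ε : ℝ) (u : ℝ → ℝ), 0 < ε → ε ≤ 1 → MemHs k s u (Ioo 0 1) →
      energy W k s ε u (Ioo 0 1) ≤ S →
      ∃ (σ : ℝ) (t : Fin M → ℝ), (σ = 1 ∨ σ = -1) ∧ (∀ i, t i ∈ Icc (0 : ℝ) 2) ∧
        ∀ θ, 0 < θ → θ ≤ 1 / 4 →
          volume {x ∈ Ioo (0 : ℝ) 1 | 1 / 2 < |u x - signStep σ t x|} ≤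
            ENNReal.ofReal (C θ * ε + θ) := by
  classical
  choose! δ hδ0 hδ using fun θ (hθ : 0 < θ) => exists_sign_of_localEnergy_le hW k hs0 hs1 hθ
  -- The number of bad windows is at most 3 near the boundary plus `4 * S / δ` of high energy. The
  -- factor 2 appears because every jump has a bad window on one of its two sides.
  refine ⟨2 * ⌊3 + 4 * S / δ (1 / 4)⌋₊, fun θ => 3 + 4 * S / δ θ, fun ε u hε hε1 hu hE => ?_⟩
  obtain ⟨hw, hg2⟩ := hu.1.weakDeriv_spec isOpen_Ioo
  rw [energy_eq_localEnergy] at hE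
  set g := weakDeriv k u (Ioo 0 1)
  have hui : IntegrableOn u (Ioo 0 1) := hu.1.1.integrable (by norm_num)
  have hgi : IntegrableOn g (Ioo 0 1) := hg2.integrable (by norm_num)
  set N := ⌈1 / ε⌉₊ with hNdef
  have hN1 : 1 / ε ≤ N := Nat.le_ceil _
  have hN2 : (N : ℝ) < 1 / ε + 1 := Nat.ceil_lt_add_one (by positivity)
  have hN0 : 0 < (N : ℝ) := lt_of_lt_of_le (by positivity) hN1
  set h : ℝ := 1 / N with hhdef
  have hh : 0 < h := by positivity
  have hNh : N * h = 1 := by rw [hhdef]; field_simp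
  have hhε : h ≤ ε := by
    rw [hhdef, div_le_iff₀ hN0]
    rwa [div_le_iff₀ hε, mul_comm] at hN1
  -- This is where `ε ≤ 1` enters: `ε * N < 1 + ε ≤ 2`.
  have hεh : ε ≤ 2 * h := by
    rw [hhdef, mul_one_div, le_div_iff₀ hN0]
    have : ε * N < ε * (1 / ε + 1) := mul_lt_mul_of_pos_left hN2 hε
    have h2 : ε * (1 / ε + 1) = 1 + ε := by field_simp
    linarith
  set sg := windowSign u h with hsg
  set good : ℝ → ℕ → Prop := fun θ j =>
    volume {x ∈ Icc (j * h) (j * h + 2 * h) | 1 / 2 < |u x - sg j|} ≤ ENNReal.ofReal (θ * h)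
    with hgood
  have hgoodE : ∀ θ, 0 < θ → θ ≤ 1 / 4 → ∀ j ∈ Finset.Icc 1 (N - 3),
      localEnergy W k s ε u g (window h j) ≤ ENNReal.ofReal (δ θ) → good θ j := by
    intro θ hθ hθ' j hj hjE
    exact windowSign_spec hh hθ.le hθ' (hδ θ hθ ε h (j * h) u g (Ioo 0 1) hh hhε hεh
      measurableSet_Ioo (window_subset hh hNh hj) hw hui hgi hg2 hjE)
  have hbad : ∀ θ, 0 < θ → θ ≤ 1 / 4 →
      ((((Finset.range N).filter fun j => ¬ good θ j).card : ℕ) : ℝ) ≤ 3 + 4 * S / δ θ := by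
    intro θ hθ hθ'
    -- The indices `0`, `N - 2`, `N - 1` are those whose enlarged windows are not counted inside the
    -- unit interval.
    have hsub : ((Finset.range N).filter fun j => ¬ good θ j) ⊆ {0, N - 2, N - 1} ∪
        ((Finset.Icc 1 (N - 3)).filter fun j =>
          ¬ localEnergy W k s ε u g (window h j) ≤ ENNReal.ofReal (δ θ)) := by
      intro j hj
      obtain ⟨hjN, hjb⟩ := Finset.mem_filter.mp hj
      rw [Finset.mem_range] at hjN
      rw [Finset.mem_union, Finset.mem_filter]
      by_cases hjv : j ∈ Finset.Icc 1 (N - 3)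
      · exact Or.inr ⟨hjv, fun hjE => hjb (hgoodE θ hθ hθ' j hjv hjE)⟩
      · left
        rw [Finset.mem_Icc] at hjv
        simp only [Finset.mem_insert, Finset.mem_singleton]
        omega
    have h1 := (Finset.card_le_card hsub).trans (Finset.card_union_le _ _)
    have h2 : ({0, N - 2, N - 1} : Finset ℕ).card ≤ 3 := Finset.card_le_three
    have h3 := card_high_energy_le W k s ε u g hh hNh hE (hδ0 θ hθ)
    have h4 : ((((Finset.range N).filter fun j => ¬ good θ j).card : ℕ) : ℝ) ≤
        3 + ((((Finset.Icc 1 (N - 3)).filter fun j =>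
          ¬ localEnergy W k s ε u g (window h j) ≤ ENNReal.ofReal (δ θ)).card : ℕ) : ℝ) := by
      exact_mod_cast h1.trans (Nat.add_le_add_right h2 _)
    linarith
  set B := (Finset.range N).filter fun j => ¬ good (1 / 4) j with hB
  set D := (Finset.range (N - 1)).filter fun j => sg j ≠ sg (j + 1) with hD
  have hDsub : D ⊆ B ∪ B.image Nat.pred := by
    intro j hj
    obtain ⟨hjN, hjs⟩ := Finset.mem_filter.mp hj
    rw [Finset.mem_range] at hjN
    rw [Finset.mem_union, Finset.mem_image]
    by_contra! hcon
    obtain ⟨hc1, hc2⟩ := hcon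
    have hj1 : good (1 / 4) j := by
      by_contra hng
      exact hc1 (Finset.mem_filter.mpr ⟨Finset.mem_range.mpr (by omega), hng⟩)
    have hj2 : good (1 / 4) (j + 1) := by
      by_contra hng
      exact hc2 (j + 1) (Finset.mem_filter.mpr ⟨Finset.mem_range.mpr (by omega), hng⟩) rfl
    exact hjs (windowSign_succ hh hj1 hj2)
  have hDcard : D.card ≤ 2 * ⌊3 + 4 * S / δ (1 / 4)⌋₊ := by
    have h1 : B.card ≤ ⌊3 + 4 * S / δ (1 / 4)⌋₊ :=
      Nat.le_floor (hbad (1 / 4) (by norm_num) le_rfl)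
    have h2 := (Finset.card_le_card hDsub).trans (Finset.card_union_le _ _)
    have h3 : (B.image Nat.pred).card ≤ B.card := Finset.card_image_le
    omega
  obtain ⟨t, ht, htx⟩ := exists_fin_prod_eq D (fun j => ((j : ℝ) + 1) * h) (fun j hj => by
    have hjN := Finset.mem_range.mp (Finset.mem_filter.mp hj).1
    have hj1 : (j : ℝ) + 1 ≤ N := by
      have : j + 1 ≤ N := by omega
      exact_mod_cast this
    refine ⟨by positivity, ?_⟩
    nlinarith) hDcard
  have hstep : ∀ x ∈ Ioo (0 : ℝ) 1, ⌊N * x⌋₊ < N ∧ signStep (sg 0) t x = sg ⌊N * x⌋₊ := by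
    intro x hx
    have hNx : 0 ≤ N * x := mul_nonneg hN0.le hx.1.le
    have hlt : ⌊N * x⌋₊ < N := by
      rw [Nat.floor_lt hNx]
      nlinarith [hx.2]
    refine ⟨hlt, ?_⟩
    rw [sign_sequence_eq (σ := sg) (windowSign_eq u h) (show ⌊N * x⌋₊ ≤ N - 1 by omega), signStep,
      ← htx x (by linarith [hx.2])]
    congr 1
    refine Finset.prod_congr rfl fun j _ => ?_
    have hiff : ((j : ℝ) + 1) * h ≤ x ↔ j < ⌊N * x⌋₊ := by
      rw [← Nat.succ_le_iff, Nat.le_floor_iff hNx, hhdef, mul_one_div, div_le_iff₀ hN0,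
        mul_comm x]
      push_cast
      rfl
    simp only [hiff]
  refine ⟨sg 0, t, windowSign_eq u h 0, ht, fun θ hθ hθ' => ?_⟩
  have hcover : {x ∈ Ioo (0 : ℝ) 1 | 1 / 2 < |u x - signStep (sg 0) t x|} ⊆
      ⋃ j ∈ Finset.range N, {x ∈ Icc (j * h) (j * h + h) | 1 / 2 < |u x - sg j|} := by
    rintro x ⟨hx, hxu⟩
    obtain ⟨hlt, hval⟩ := hstep x hx
    have hNx : 0 ≤ N * x := mul_nonneg hN0.le hx.1.le
    have f1 := Nat.floor_le hNx
    have f2 := Nat.lt_floor_add_one (N * x)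
    have hxN : x = N * x * h := by rw [hhdef]; field_simp
    simp only [mem_iUnion, Finset.mem_range]
    refine ⟨⌊N * x⌋₊, hlt, ⟨?_, ?_⟩, by rwa [← hval]⟩
    · calc (⌊N * x⌋₊ : ℝ) * h ≤ N * x * h := by gcongr
        _ = x := hxN.symm
    · calc x = N * x * h := hxN
        _ ≤ (⌊N * x⌋₊ + 1) * h := by gcongr
        _ = _ := by ring
  -- A good cell contributes at most `θ * h`, a bad one at most its length `h`; the good part sums
  -- to `θ` because `N * h = 1`.
  have hcell : ∀ j ∈ Finset.range N,
      volume {x ∈ Icc (j * h) (j * h + h) | 1 / 2 < |u x - sg j|} ≤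
        ENNReal.ofReal (θ * h + if ¬ good θ j then h else 0) := by
    intro j _
    by_cases hj : good θ j
    · rw [if_neg (not_not.mpr hj), add_zero]
      refine (measure_mono ?_).trans hj
      rintro x ⟨hx, hxu⟩
      exact ⟨⟨hx.1, by linarith [hx.2]⟩, hxu⟩
    · rw [if_pos hj]
      refine (measure_mono (fun x hx => hx.1)).trans ?_
      rw [Real.volume_Icc]
      refine ENNReal.ofReal_le_ofReal ?_
      have : 0 < θ * h := by positivity
      linarith
  calc volume {x ∈ Ioo (0 : ℝ) 1 | 1 / 2 < |u x - signStep (sg 0) t x|}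
      ≤ ∑ j ∈ Finset.range N, volume {x ∈ Icc (j * h) (j * h + h) | 1 / 2 < |u x - sg j|} :=
        (measure_mono hcover).trans (measure_biUnion_finset_le _ _)
    _ ≤ ∑ j ∈ Finset.range N, ENNReal.ofReal (θ * h + if ¬ good θ j then h else 0) :=
        Finset.sum_le_sum hcell
    _ = ENNReal.ofReal (∑ j ∈ Finset.range N, (θ * h + if ¬ good θ j then h else 0)) :=
        (ENNReal.ofReal_sum_of_nonneg fun j _ => by split_ifs <;> positivity).symm
    _ ≤ ENNReal.ofReal ((3 + 4 * S / δ θ) * ε + θ) := by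
        refine ENNReal.ofReal_le_ofReal ?_
        rw [Finset.sum_add_distrib, ← Finset.sum_filter, Finset.sum_const, Finset.sum_const,
          Finset.card_range, nsmul_eq_mul, nsmul_eq_mul]
        have h1 := hbad θ hθ hθ'
        have h2 : (N : ℝ) * (θ * h) = θ := by
          calc (N : ℝ) * (θ * h) = θ * (N * h) := by ring
            _ = θ := by rw [hNh, mul_one]
        have h3 : ((((Finset.range N).filter fun j => ¬ good θ j).card : ℕ) : ℝ) * h ≤
            (3 + 4 * S / δ θ) * ε :=
          mul_le_mul h1 hhε hh.le ((Nat.cast_nonneg _).trans h1)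
        linarith

/-! ### Compactness of step functions -/

lemma signStep_eq {M : ℕ} {σ : ℝ} (hσ : σ = 1 ∨ σ = -1) (t : Fin M → ℝ) (x : ℝ) :
    signStep σ t x = 1 ∨ signStep σ t x = -1 := by
  have h : (∏ i, if t i ≤ x then (-1 : ℝ) else 1) = 1 ∨
      (∏ i, if t i ≤ x then (-1 : ℝ) else 1) = -1 := by
    refine Finset.prod_induction _ (fun y : ℝ => y = 1 ∨ y = -1) ?_ (Or.inl rfl) ?_
    · rintro a b (rfl | rfl) (rfl | rfl) <;> norm_num
    · intro i _
      split_ifs <;> simp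
  unfold signStep
  rcases hσ with rfl | rfl <;> rcases h with h | h <;> rw [h] <;> norm_num

lemma measurable_signStep {M : ℕ} (σ : ℝ) (t : Fin M → ℝ) : Measurable (signStep σ t) :=
  (Finset.measurable_prod _ fun _ _ =>
    Measurable.ite measurableSet_Ici measurable_const measurable_const).const_mul σ

/-- Each factor is minus a monotone bounded function, and products of functions of bounded variation
have bounded variation. -/
lemma boundedVariationOn_signStep {M : ℕ} (σ : ℝ) (t : Fin M → ℝ) :
    BoundedVariationOn (signStep σ t) (Ioo 0 1) := by
  have hconst : ∀ c : ℝ, BoundedVariationOn (fun _ : ℝ => c) (Ioo 0 1) := fun c => by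
    rw [BoundedVariationOn, eVariationOn.constant_on]
    · simp
    · rintro _ ⟨_, _, rfl⟩ _ ⟨_, _, rfl⟩
      rfl
  have hfac : ∀ a : ℝ, BoundedVariationOn (fun x : ℝ => if a ≤ x then (-1 : ℝ) else 1)
      (Ioo 0 1) := by
    intro a
    have hmono : MonotoneOn (fun x : ℝ => if a ≤ x then (1 : ℝ) else -1) univ := by
      intro x _ y _ hxy
      dsimp only
      split_ifs <;> linarith
    have h1 : BoundedVariationOn (fun x : ℝ => if a ≤ x then (1 : ℝ) else -1) (Ioo 0 1) := by
      have h := (hmono.eVariationOn_eq (a := 0) (b := 1) (mem_univ _) (mem_univ _)).le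
      refine ne_top_of_le_ne_top ENNReal.ofReal_ne_top ((eVariationOn.mono _ ?_).trans h)
      exact fun x hx => ⟨mem_univ _, hx.1.le, hx.2.le⟩
    convert (hconst (-1)).mul h1 using 1
    funext x
    simp only [Pi.mul_apply]
    split_ifs <;> norm_num
  have hprod : ∀ s : Finset (Fin M),
      BoundedVariationOn (fun x => ∏ i ∈ s, if t i ≤ x then (-1 : ℝ) else 1) (Ioo 0 1) := by
    classical
    intro s
    induction s using Finset.induction_on with
    | empty => simpa using hconst 1
    | insert a s ha ih =>
      simp only [Finset.prod_insert ha]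
      exact (hfac (t a)).mul ih
  exact (hconst σ).mul (hprod Finset.univ)

/-- Away from the limiting jump points every factor is eventually constant. Jumps that merge or
leave the interval cause no difficulty. -/
lemma tendsto_signStep {M : ℕ} {σ : ℕ → ℝ} {t : ℕ → Fin M → ℝ} {σ₀ : ℝ} {t₀ : Fin M → ℝ}
    (hσ : Tendsto σ atTop (𝓝 σ₀)) (ht : Tendsto t atTop (𝓝 t₀)) {x : ℝ} (hx : ∀ i, t₀ i ≠ x) :
    Tendsto (fun n => signStep (σ n) (t n) x) atTop (𝓝 (signStep σ₀ t₀ x)) := by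
  refine hσ.mul (tendsto_finsetProd _ fun i _ => ?_)
  have hti : Tendsto (fun n => t n i) atTop (𝓝 (t₀ i)) := (tendsto_pi_nhds.mp ht) i
  refine tendsto_const_nhds.congr' ?_
  rcases lt_or_gt_of_ne (hx i) with h | h
  · filter_upwards [hti.eventually (gt_mem_nhds h)] with n hn
    rw [if_pos h.le, if_pos hn.le]
  · filter_upwards [hti.eventually (lt_mem_nhds h)] with n hn
    rw [if_neg (not_le.mpr h), if_neg (not_le.mpr hn)]

/-- Compactness of step functions with values in `{-1, 1}` and a bounded number of jumps. -/
lemma exists_subseq_signStep {M : ℕ} {σ : ℕ → ℝ} {t : ℕ → Fin M → ℝ}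
    (hσ : ∀ n, σ n = 1 ∨ σ n = -1) (ht : ∀ n i, t n i ∈ Icc (0 : ℝ) 2) :
    ∃ (σ₀ : ℝ) (t₀ : Fin M → ℝ) (φ : ℕ → ℕ), (σ₀ = 1 ∨ σ₀ = -1) ∧ StrictMono φ ∧
      TendstoInMeasure (volume.restrict (Ioo (0 : ℝ) 1))
        (fun n => signStep (σ (φ n)) (t (φ n))) atTop (signStep σ₀ t₀) := by
  -- The parameters (initial sign, jump points) range over a compact set, so compactness of the
  -- functions reduces to Bolzano–Weierstrass.
  have hc : IsCompact (({1, -1} : Set ℝ) ×ˢ (univ.pi fun _ : Fin M => Icc (0 : ℝ) 2)) :=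
    (Set.toFinite _).isCompact.prod (isCompact_univ_pi fun _ => isCompact_Icc)
  obtain ⟨⟨σ₀, t₀⟩, hmem, φ, hφ, hlim⟩ := hc.tendsto_subseq (x := fun n => (σ n, t n))
    (fun n => ⟨hσ n, fun i _ => ht n i⟩)
  rw [nhds_prod_eq, tendsto_prod_iff'] at hlim
  refine ⟨σ₀, t₀, φ, hmem.1, hφ, tendstoInMeasure_of_tendsto_ae
    (fun n => (measurable_signStep _ _).aestronglyMeasurable) ?_⟩
  refine ae_restrict_of_ae ?_
  have hnull : ∀ᵐ x : ℝ, ∀ i, t₀ i ≠ x := by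
    rw [ae_all_iff]
    intro i
    filter_upwards [(measure_eq_zero_iff_ae_notMem).mp
      (measure_singleton (μ := (volume : Measure ℝ)) (t₀ i))] with x hx h
    exact hx h.symm
  filter_upwards [hnull] with x hx
  exact tendsto_signStep hlim.1 hlim.2 hx

/-! ### Convergence in measure and in `L^p` -/

lemma lintegral_potential_le {W : ℝ → ℝ} {k : ℕ} {s ε : ℝ} {u : ℝ → ℝ} {I : Set ℝ} {S : ℝ≥0}
    (hε : 0 < ε) (h : energy W k s ε u I ≤ S) :
    ∫⁻ x in I, ENNReal.ofReal (W (u x)) ≤ ENNReal.ofReal (S * ε) := by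
  have h1 : ENNReal.ofReal (1 / ε) * (∫⁻ x in I, ENNReal.ofReal (W (u x))) ≤
      ENNReal.ofReal (S : ℝ) := by
    rw [ENNReal.ofReal_coe_nnreal]
    exact le_self_add.trans h
  have := le_ofReal_div_of_mul_le (by positivity) h1
  rwa [div_div_eq_mul_div, div_one] at this

/-- If `u n` is close to `{-1, 1}` and to `w n` in measure, and `w n` takes values in `{-1, 1}` and
converges in measure, then so does `u n`. -/
lemma tendstoInMeasure_of_close {μ : Measure ℝ} {u w : ℕ → ℝ → ℝ} {v : ℝ → ℝ}
    (hw : ∀ n x, w n x = 1 ∨ w n x = -1) (hv : ∀ x, v x = 1 ∨ v x = -1)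
    (hwv : TendstoInMeasure μ w atTop v)
    (hfar : ∀ τ > 0, Tendsto (fun n => μ {x | τ ≤ |u n x - 1| ∧ τ ≤ |u n x + 1|}) atTop (𝓝 0))
    (huw : Tendsto (fun n => μ {x | 1 / 2 < |u n x - w n x|}) atTop (𝓝 0)) :
    TendstoInMeasure μ u atTop v := by
  rw [tendstoInMeasure_iff_dist] at hwv ⊢
  intro τ hτ
  set τ' := min τ (1 / 2) with hτ'
  have hτ0 : 0 < τ' := by positivity
  -- At level 1 the last set is exactly where `w n` and `v` differ. Off all three sets `u n` is
  -- within `1 / 2` of `v`, so the well it is `τ'`-close to must be `v`.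
  have hsum := ((hfar τ' hτ0).add huw).add (hwv 1 one_pos)
  simp only [add_zero] at hsum
  refine tendsto_of_tendsto_of_tendsto_of_le_of_le tendsto_const_nhds hsum (fun _ => zero_le)
    fun n => ?_
  refine (measure_mono ?_).trans ((measure_union_le _ _).trans
    (add_le_add (measure_union_le _ _) le_rfl))
  intro x hx
  by_contra hcon
  simp only [mem_union, mem_ofPred_eq, not_or, not_and, not_le, not_lt, Real.dist_eq] at hcon hx
  obtain ⟨⟨h1, h2⟩, h3⟩ := hcon
  have ht1 : τ' ≤ τ := min_le_left _ _
  have ht2 : τ' ≤ 1 / 2 := min_le_right _ _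
  have hwv' : w n x = v x := by
    rcases hw n x with e1 | e1 <;> rcases hv x with e2 | e2 <;> rw [e1, e2] at h3 ⊢ <;>
      norm_num at h3
  rw [hwv', abs_le] at h2
  by_cases hc : τ' ≤ |u n x - 1|
  · have h4 := abs_lt.mp (h1 hc)
    rcases hv x with e | e <;> rw [e] at h2 hx
    · linarith
    · rw [sub_neg_eq_add] at hx
      linarith [h1 hc]
  · have h4 := abs_lt.mp (not_le.mp hc)
    rcases hv x with e | e <;> rw [e] at h2 hx
    · linarith [not_le.mp hc]
    · linarith

/-- Under a `p`-growth condition the `L^p`-distance to a function with values in `[-1, 1]` is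
controlled by convergence in measure and the potential energy. -/
lemma exists_lintegral_rpow_le {W : ℝ → ℝ} (hW : Continuous W)
    {c₁ c₂ p : ℝ} (hc₁ : 0 < c₁) (hp : 1 ≤ p) (hgrowth : ∀ z : ℝ, c₁ * |z| ^ p - c₂ ≤ W z)
    (hW0 : ∀ z, 0 ≤ W z) :
    ∃ A B : ℝ, ∀ (μ : Measure ℝ) (u v : ℝ → ℝ) (τ : ℝ), 0 < τ → AEMeasurable u μ →
      (∀ x, |v x| ≤ 1) →
      ∫⁻ x, ‖u x - v x‖ₑ ^ p ∂μ ≤ ENNReal.ofReal (τ ^ p) * μ univ +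
        ENNReal.ofReal A * (∫⁻ x, ENNReal.ofReal (W (u x)) ∂μ) +
        ENNReal.ofReal B * μ {x | τ ≤ |u x - v x|} := by
  have hp0 : 0 ≤ p := by linarith
  -- Beyond `R` the constant `c₂` is absorbed by half of `c₁ * |z| ^ p`, and `|z| + 1 ≤ 2 * |z|`.
  set R : ℝ := max 1 (2 * |c₂| / c₁) with hR
  have hR1 : 1 ≤ R := le_max_left _ _
  have hR2 : 2 * |c₂| ≤ c₁ * R := by
    have : 2 * |c₂| / c₁ ≤ R := le_max_right _ _
    rw [div_le_iff₀ hc₁] at this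
    linarith
  refine ⟨2 ^ p * (2 / c₁), (R + 1) ^ p, fun μ u v τ hτ hu hv => ?_⟩
  have hpt : ∀ x, |u x - v x| ^ p ≤ τ ^ p + 2 ^ p * (2 / c₁) * W (u x) +
      {x | τ ≤ |u x - v x|}.indicator (fun _ => (R + 1) ^ p) x := by
    intro x
    have hi : 0 ≤ {x | τ ≤ |u x - v x|}.indicator (fun _ => (R + 1) ^ p) x :=
      indicator_nonneg (fun _ _ => by positivity) _
    have hτp : 0 ≤ τ ^ p := by positivity
    have hWp : 0 ≤ 2 ^ p * (2 / c₁) * W (u x) := mul_nonneg (by positivity) (hW0 _)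
    have hle : |u x - v x| ≤ |u x| + 1 := (abs_sub _ _).trans (by linarith [hv x])
    by_cases hbig : R < |u x|
    · have h1 : |u x - v x| ^ p ≤ (2 * |u x|) ^ p :=
        Real.rpow_le_rpow (abs_nonneg _) (by linarith) hp0
      rw [Real.mul_rpow (by norm_num) (abs_nonneg _)] at h1
      have h2 : |u x| ≤ |u x| ^ p := Real.self_le_rpow_of_one_le (by linarith) hp
      have h3 : |u x| ^ p ≤ 2 / c₁ * W (u x) := by
        rw [div_mul_eq_mul_div, le_div_iff₀ hc₁]
        have := hgrowth (u x)
        have := le_abs_self c₂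
        nlinarith
      have h4 : (2 : ℝ) ^ p * |u x| ^ p ≤ 2 ^ p * (2 / c₁ * W (u x)) := by gcongr
      linarith
    · by_cases hsm : τ ≤ |u x - v x|
      · rw [indicator_of_mem (by exact hsm)]
        have : |u x - v x| ^ p ≤ (R + 1) ^ p :=
          Real.rpow_le_rpow (abs_nonneg _) (by linarith [not_lt.mp hbig]) hp0
        linarith
      · have : |u x - v x| ^ p ≤ τ ^ p :=
          Real.rpow_le_rpow (abs_nonneg _) (not_le.mp hsm).le hp0
        linarith
  have hpt' : ∀ x, ‖u x - v x‖ₑ ^ p ≤ (ENNReal.ofReal (τ ^ p) +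
      ENNReal.ofReal (2 ^ p * (2 / c₁)) * ENNReal.ofReal (W (u x))) +
      {x | τ ≤ |u x - v x|}.indicator (fun _ => ENNReal.ofReal ((R + 1) ^ p)) x := by
    intro x
    rw [Real.enorm_eq_ofReal_abs, ENNReal.ofReal_rpow_of_nonneg (abs_nonneg _) hp0]
    refine (ENNReal.ofReal_le_ofReal (hpt x)).trans ?_
    rw [← ENNReal.ofReal_mul (by positivity)]
    refine ENNReal.ofReal_add_le.trans (add_le_add ENNReal.ofReal_add_le (le_of_eq ?_))
    by_cases hx : τ ≤ |u x - v x| <;> simp [indicator, hx]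
  have hWm : AEMeasurable (fun x => ENNReal.ofReal (W (u x))) μ :=
    (hW.measurable.comp_aemeasurable hu).ennreal_ofReal
  refine (lintegral_mono hpt').trans ?_
  have hm : AEMeasurable (fun x => ENNReal.ofReal (τ ^ p) +
      ENNReal.ofReal (2 ^ p * (2 / c₁)) * ENNReal.ofReal (W (u x))) μ :=
    aemeasurable_const.add (hWm.const_mul _)
  rw [lintegral_add_left' hm,
    lintegral_add_left measurable_const, lintegral_const, lintegral_const_mul'' _ hWm]
  exact add_le_add le_rfl (lintegral_indicator_const_le _ _)

/-- Under a `p`-growth condition on `W`, convergence in measure and vanishing potential energy give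
convergence in `L^p`. -/
lemma tendsto_eLpNorm_of_tendstoInMeasure {W : ℝ → ℝ} (hW : IsDoubleWell W) {c₁ c₂ p : ℝ}
    (hc₁ : 0 < c₁) (hp : 1 ≤ p) (hgrowth : ∀ z : ℝ, c₁ * |z| ^ p - c₂ ≤ W z)
    {μ : Measure ℝ} [IsProbabilityMeasure μ] {u : ℕ → ℝ → ℝ} {v : ℝ → ℝ}
    (hu : ∀ n, AEStronglyMeasurable (u n) μ) (hvm : AEStronglyMeasurable v μ)
    (hv : ∀ x, |v x| ≤ 1) (hWfin : ∀ n, ∫⁻ x, ENNReal.ofReal (W (u n x)) ∂μ ≠ ⊤)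
    (hWlim : Tendsto (fun n => ∫⁻ x, ENNReal.ofReal (W (u n x)) ∂μ) atTop (𝓝 0))
    (huv : TendstoInMeasure μ u atTop v) :
    MemLp v (ENNReal.ofReal p) μ ∧ (∀ n, MemLp (u n) (ENNReal.ofReal p) μ) ∧
      Tendsto (fun n => eLpNorm (u n - v) (ENNReal.ofReal p) μ) atTop (𝓝 0) := by
  obtain ⟨A, B, hAB⟩ := exists_lintegral_rpow_le hW.continuous hc₁ hp hgrowth hW.nonneg
  have hp0 : 0 < p := by linarith
  have hpne : ENNReal.ofReal p ≠ 0 := by simpa using hp0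
  have hpr : (ENNReal.ofReal p).toReal = p := ENNReal.toReal_ofReal hp0.le
  have hnorm : ∀ n, eLpNorm (u n - v) (ENNReal.ofReal p) μ =
      (∫⁻ x, ‖u n x - v x‖ₑ ^ p ∂μ) ^ (1 / p) := fun n => by
    rw [eLpNorm_eq_lintegral_rpow_enorm_toReal hpne ENNReal.ofReal_ne_top, hpr]
    rfl
  have hvL : MemLp v (ENNReal.ofReal p) μ :=
    MemLp.of_bound hvm 1 (Eventually.of_forall hv)
  refine ⟨hvL, fun n => ?_, ?_⟩
  · have h1 := hAB μ (u n) v 1 one_pos (hu n).aemeasurable hv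
    have h2 : MemLp (u n - v) (ENNReal.ofReal p) μ := by
      refine ⟨(hu n).sub hvm, ?_⟩
      rw [hnorm n]
      refine ENNReal.rpow_lt_top_of_nonneg (by positivity) (ne_top_of_le_ne_top ?_ h1)
      have := hWfin n
      finiteness
    simpa using h2.add hvL
  · have hlim : Tendsto (fun n => ∫⁻ x, ‖u n x - v x‖ₑ ^ p ∂μ) atTop (𝓝 0) := by
      rw [ENNReal.tendsto_nhds_zero]
      intro η hη
      obtain ⟨τ, hτ0, hτη⟩ := ENNReal.lt_iff_exists_nnreal_btwn.mp hη
      -- Truncating at 1 ensures `τ' ^ p ≤ τ'`.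
      set τ' : ℝ := min (τ : ℝ) 1 with hτ'
      have hτpos : 0 < (τ : ℝ) := by exact_mod_cast hτ0
      have hτ'0 : 0 < τ' := lt_min hτpos one_pos
      have hτp : ENNReal.ofReal (τ' ^ p) < η := by
        refine lt_of_le_of_lt ?_ hτη
        rw [← ENNReal.ofReal_coe_nnreal]
        refine ENNReal.ofReal_le_ofReal ?_
        calc τ' ^ p ≤ τ' ^ (1 : ℝ) :=
              Real.rpow_le_rpow_of_exponent_ge hτ'0 (min_le_right _ _) hp
          _ = τ' := Real.rpow_one _
          _ ≤ τ := min_le_left _ _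
      rw [tendstoInMeasure_iff_dist] at huv
      have hb := ((tendsto_const_nhds (x := ENNReal.ofReal (τ' ^ p) * μ univ)).add
        (ENNReal.Tendsto.const_mul (a := ENNReal.ofReal A) hWlim (Or.inr (by simp)))).add
        (ENNReal.Tendsto.const_mul (a := ENNReal.ofReal B) (huv τ' hτ'0) (Or.inr (by simp)))
      simp only [mul_zero, add_zero, measure_univ, mul_one] at hb
      filter_upwards [hb.eventually (gt_mem_nhds hτp)] with n hn
      have h1 := hAB μ (u n) v τ' hτ'0 (hu n).aemeasurable hv
      rw [measure_univ, mul_one] at h1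
      exact h1.trans hn.le
    have h := ((ENNReal.continuous_rpow_const (y := 1 / p)).tendsto 0).comp hlim
    rw [ENNReal.zero_rpow_of_pos (by positivity)] at h
    exact h.congr fun n => (hnorm n).symm

end PhaseTransition

/-! ### The compactness theorem -/

open PhaseTransition

theorem theorem2 (k : ℕ) (s : ℝ) (hs0 : 0 ≤ s) (hs1 : s < 1) (hks : 1 / 2 < (k : ℝ) + s)
    (W : ℝ → ℝ) (hW : PhaseTransition.IsDoubleWell W)
    (u : ℝ → ℝ → ℝ) (S : ℝ≥0)
    (hu : ∀ ε : ℝ, 0 < ε → PhaseTransition.MemHs k s (u ε) (Ioo 0 1))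
    (hS : ∀ ε : ℝ, 0 < ε → PhaseTransition.energy W k s ε (u ε) (Ioo 0 1) ≤ S)
    (e : ℕ → ℝ) (he_pos : ∀ j, 0 < e j) (he_lim : Tendsto e atTop (𝓝 0)) :
    ∃ (v : ℝ → ℝ) (r : ℕ → ℕ), PhaseTransition.MemBVSign v (Ioo 0 1) ∧ StrictMono r ∧
      TendstoInMeasure (volume.restrict (Ioo (0 : ℝ) 1)) (fun j => u (e (r j))) atTop v ∧
      ∀ c₁ c₂ p : ℝ, 0 < c₁ → 1 ≤ p → (∀ z : ℝ, c₁ * |z| ^ p - c₂ ≤ W z) →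
        MemLp v (ENNReal.ofReal p) (volume.restrict (Ioo (0 : ℝ) 1)) ∧
        (∀ j, MemLp (u (e (r j))) (ENNReal.ofReal p) (volume.restrict (Ioo (0 : ℝ) 1))) ∧
        Tendsto (fun j => eLpNorm (u (e (r j)) - v) (ENNReal.ofReal p)
          (volume.restrict (Ioo (0 : ℝ) 1))) atTop (𝓝 0) := by
  obtain ⟨M, C, hMC⟩ := exists_signStep_close hW k hs0 hs1 S
  -- The sequence is shifted so that `ε ≤ 1`, as the step function approximation requires.
  obtain ⟨n₀, hn₀⟩ := eventually_atTop.mp (he_lim.eventually (gt_mem_nhds one_pos))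
  have hstep := fun n => hMC (e (n + n₀)) (u (e (n + n₀))) (he_pos _)
    (hn₀ _ (Nat.le_add_left _ _)).le (hu _ (he_pos _)) (hS _ (he_pos _))
  choose σ t hσ ht hclose using hstep
  obtain ⟨σ₀, t₀, φ, hσ₀, hφ, hlim⟩ := exists_subseq_signStep hσ ht
  set r : ℕ → ℕ := fun n => φ n + n₀ with hr
  have hrmono : StrictMono r := hφ.add_const n₀
  have her : Tendsto (fun n => e (r n)) atTop (𝓝 0) := he_lim.comp hrmono.tendsto_atTop
  set μ := volume.restrict (Ioo (0 : ℝ) 1) with hμ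
  have : IsProbabilityMeasure μ := ⟨by simp [hμ]⟩
  have hum : ∀ n, AEStronglyMeasurable (u (e (r n))) μ :=
    fun n => (hu _ (he_pos _)).1.1.aestronglyMeasurable
  have hWle : ∀ n, ∫⁻ x, ENNReal.ofReal (W (u (e (r n)) x)) ∂μ ≤ ENNReal.ofReal (S * e (r n)) :=
    fun n => lintegral_potential_le (he_pos _) (hS _ (he_pos _))
  have hWlim : Tendsto (fun n => ∫⁻ x, ENNReal.ofReal (W (u (e (r n)) x)) ∂μ) atTop (𝓝 0) := by
    have h := ENNReal.tendsto_ofReal (her.const_mul (S : ℝ))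
    rw [mul_zero, ENNReal.ofReal_zero] at h
    exact tendsto_of_tendsto_of_tendsto_of_le_of_le tendsto_const_nhds h (fun _ => zero_le) hWle
  have hmeas : TendstoInMeasure μ (fun n => u (e (r n))) atTop (signStep σ₀ t₀) := by
    refine tendstoInMeasure_of_close (fun n x => signStep_eq (hσ _) _ x)
      (signStep_eq hσ₀ t₀) hlim (fun τ hτ => ?_) ?_
    · obtain ⟨c, hc, hfar⟩ := hW.measure_far_le hτ
      have h := ENNReal.tendsto_ofReal ((her.const_mul (S : ℝ)).div_const c)
      rw [mul_zero, zero_div, ENNReal.ofReal_zero] at h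
      refine tendsto_of_tendsto_of_tendsto_of_le_of_le tendsto_const_nhds h (fun _ => zero_le)
        fun n => ?_
      refine le_ofReal_div_of_mul_le hc (le_trans (le_of_eq ?_) ((hfar (u (e (r n))) (Ioo 0 1)
        measurableSet_Ioo (hum n).aemeasurable).trans (hWle n)))
      rw [hμ, Measure.restrict_apply' measurableSet_Ioo]
      congr 2
      ext x
      simp [and_comm]
    · rw [ENNReal.tendsto_nhds_zero]
      intro η hη
      obtain ⟨τ, hτ0, hτη⟩ := ENNReal.lt_iff_exists_nnreal_btwn.mp hη
      have hτpos : 0 < (τ : ℝ) := by exact_mod_cast hτ0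
      -- The step functions do not depend on `θ`: for fixed `θ` the term `C θ * ε` vanishes in the
      -- limit, and `θ` itself is arbitrarily small.
      set θ : ℝ := min (τ : ℝ) (1 / 4) with hθ
      have hθ0 : 0 < θ := lt_min hτpos (by norm_num)
      have h := ENNReal.tendsto_ofReal ((her.const_mul (C θ)).add_const θ)
      rw [mul_zero, zero_add] at h
      have hlt : ENNReal.ofReal θ < η := by
        refine lt_of_le_of_lt ?_ hτη
        rw [← ENNReal.ofReal_coe_nnreal]
        exact ENNReal.ofReal_le_ofReal (min_le_left _ _)
      filter_upwards [h.eventually (gt_mem_nhds hlt)] with n hn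
      refine le_trans (le_of_eq ?_) ((hclose (φ n) θ hθ0 (min_le_right _ _)).trans hn.le)
      rw [hμ, Measure.restrict_apply' measurableSet_Ioo]
      congr 1
      ext x
      simp [and_comm, hr]
  refine ⟨signStep σ₀ t₀, r, ⟨boundedVariationOn_signStep σ₀ t₀, fun x _ =>
    (signStep_eq hσ₀ t₀ x).symm⟩, hrmono, hmeas, fun c₁ c₂ p hc₁ hp hgrowth => ?_⟩
  refine tendsto_eLpNorm_of_tendstoInMeasure hW hc₁ hp hgrowth hum
    (measurable_signStep σ₀ t₀).aestronglyMeasurable (fun x => ?_)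
    (fun n => ne_top_of_le_ne_top ENNReal.ofReal_ne_top (hWle n)) hWlim hmeas
  rcases signStep_eq hσ₀ t₀ x with h | h <;> rw [h] <;> norm_num
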